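/- Let $B$ be a compact smooth manifold without boundary with a Riemannian metric $g$, and let $J^1B=T^*B\times\mathbb R$, with points $(q,p,z)$, contact form $\lambda=dz-p\,dq$, contact distribution $\xi=\ker\lambda$, Reeb field $R_\lambda=\partial_z$, projection $\Pi:T(J^1B)\to\xi$ along $R_\lambda$, and zero section $o_{J^1B}=\{p=0,z=0\}$. Let $D_r(J^1B)=\{|p|_g^2+z^2\le r^2\}$ be the closed disc bundle of radius $r$. Let $H:[0,1]\times J^1B\to\mathbb R$ be a smooth compactly supported contact Hamiltonian, $X_H$ its contact vector field ($\lambda(X_H)=-H$, $X_H\rfloor d\lambda=dH-R_\lambda[H]\lambda$), $\psi_H^t$ its flow and $\phi_H^t=\psi_H^t\circ(\psi_H^1)^{-1}$. Assume that $\psi_H^1(o_{J^1B})$ is transverse to $Z=o_{T^*B}\times\mathbb R$. Let $J=\{J_t\}_{t\in[0,1]}$ be a smooth family (for instance a constant one) of $\lambda$-adapted CR almost complex structures on $J^1B$, i.e. $J_t^2=-\Pi$, $J_tR_\lambda=0$ and $d\lambda(Y,J_tY)>0$ for $0\ne Y\in\xi$, such that, outside some compact subset of $J^1B$, every $J_t$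 equals the lift to $\xi$ of the Sasakian almost complex structure $J_g$ of $T^*B$. A Reeb chord $(\overline\gamma,T)$ from $\psi_H^1(o_{J^1B})$ to $o_{J^1B}$ is a path $\overline\gamma:[0,1]\to J^1B$ with $\dot{\overline\gamma}=T\,R_\lambda(\overline\gamma)$, $T\in\mathbb R$, $\overline\gamma(0)\in\psi_H^1(o_{J^1B})$ and $\overline\gamma(1)\in o_{J^1B}$. On $\mathbb R\times[0,1]$ with coordinates $(\tau,t)$ let $j\partial_\tau=\partial_t$; for a $TJ^1B$-valued one-form $A$ put $A^{\pi(0,1)}=\frac12(\Pi A+J_t\,\Pi A\circ j)$. (1) There is a constant $r=r(H,J)>0$ such that, for all Reeb chords $(\overline\gamma_\pm,T_\pm)$ from $\psi_H^1(o_{J^1B})$ to $o_{J^1B}$, every smooth map $w:\mathbb R\times[0,1]\to J^1B$ with $$(dw)^{\pi(0,1)}=0,\quad d(w^*\lambda\circ j)=0,\quad w(\tau,0)\in\psi_H^1(o_{J^1B}),\quad w(\tau,1)\in o_{J^1B},\quad \lim_{\tau\to\pm\infty}w(\tau,\cdot)=\overline\gamma_\pm\ \text{ in } C^0([0,1])$$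 satisfies $\operatorname{Image} w\subset D_r(J^1B)$. (2) There is a constant $r=r(H,J)>0$ such that, for all Reeb chords $(\overline\gamma_\pm,T_\pm)$ as in (1), every smooth map $u:\mathbb R\times[0,1]\to J^1B$ with $$(du-X_H\otimes dt)^{\pi(0,1)}=0,\quad d\bigl(e^{g_{H,u}}(u^*\lambda+H\,dt)\circ j\bigr)=0,\quad u(\tau,0),\,u(\tau,1)\in o_{J^1B},\quad \lim_{\tau\to\pm\infty}u(\tau,t)=\phi_H^t(\overline\gamma_\pm(t))\ \text{ uniformly in } t\in[0,1]$$ satisfies $\operatorname{Image} u\subset D_r(J^1B)$. Here $g_{H,u}(\tau,t)=g_{(\phi_H^t)^{-1}}(u(\tau,t))$, where $\chi^*\lambda=e^{g_\chi}\lambda$. -/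

import Mathlib

open Set Filter Topology Manifold ContDiff

noncomputable section

/-! ## The cotangent bundle and the one-jet bundle of a manifold `B` of dimension `n` -/

/-- The model space of `B`. -/
abbrev BaseModel (n : ℕ) : Type := EuclideanSpace ℝ (Fin n)

/-- The cotangent bundle `T^*B`, as the bundle of continuous linear forms on the tangent spaces.
A point is written `⟨q, p⟩`. -/
abbrev CotangentBundle (n : ℕ) (B : Type*) [TopologicalSpace B] [ChartedSpace (BaseModel n) B]
    [IsManifold (𝓡 n) ∞ B] : Type _ :=
  Bundle.TotalSpace (BaseModel n →L[ℝ] ℝ)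
    (fun q : B => TangentSpace (𝓡 n) q →L[ℝ] Bundle.Trivial B ℝ q)

/-- The one-jet bundle `J^1B = T^*B × ℝ`. A point is written `(⟨q, p⟩, z)`. -/
abbrev OneJet (n : ℕ) (B : Type*) [TopologicalSpace B] [ChartedSpace (BaseModel n) B]
    [IsManifold (𝓡 n) ∞ B] : Type _ :=
  CotangentBundle n B × ℝ

/-- The model vector space of `J^1B`, with coordinates `((q, p), z)`. -/
abbrev JetModel (n : ℕ) : Type := (BaseModel n × (BaseModel n →L[ℝ] ℝ)) × ℝ

/-- The model with corners of `J^1B` (there is no boundary). -/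
abbrev jetI (n : ℕ) :
    ModelWithCorners ℝ (JetModel n)
      (ModelProd (ModelProd (BaseModel n) (BaseModel n →L[ℝ] ℝ)) ℝ) :=
  ((𝓡 n).prod 𝓘(ℝ, BaseModel n →L[ℝ] ℝ)).prod 𝓘(ℝ, ℝ)

/-- The closed unit interval `[0,1]` as a set of times. -/
abbrev unitTime : Set ℝ := Icc (0 : ℝ) 1

section Jet

variable {n : ℕ} {B : Type*} [TopologicalSpace B] [ChartedSpace (BaseModel n) B]
  [IsManifold (𝓡 n) ∞ B]

instance : TopologicalSpace (CotangentBundle n B) := inferInstance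

instance : ChartedSpace (ModelProd (BaseModel n) (BaseModel n →L[ℝ] ℝ)) (CotangentBundle n B) :=
  inferInstance

instance : ChartedSpace (ModelProd (ModelProd (BaseModel n) (BaseModel n →L[ℝ] ℝ)) ℝ)
    (OneJet n B) := inferInstance

/-- The tangent space `T_y J^1B` in canonical coordinates. The preferred chart of `J^1B` at
`y = (⟨q, p⟩, z)` is the canonical chart `(q^i, p_i, z)` induced by the preferred chart of `B`
at `q`, and a tangent vector at `y` is by definition its coordinate vector in that chart:
`((a, b), c)` stands for `a^i ∂/∂q^i + b_i ∂/∂p_i + c ∂/∂z`. -/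
def jetCoord (y : OneJet n B) : TangentSpace (jetI n) y ≃L[ℝ] JetModel n :=
  ContinuousLinearEquiv.refl ℝ (JetModel n)

/-- The covector `p` of `y = (⟨q, p⟩, z)`, as a linear form on the coordinate space. -/
def covector (y : OneJet n B) : BaseModel n →L[ℝ] ℝ := y.1.2

/-- The standard contact form `λ = dz - p dq`. -/
def contactForm (y : OneJet n B) : TangentSpace (jetI n) y →L[ℝ] ℝ :=
  (ContinuousLinearMap.snd ℝ (BaseModel n × (BaseModel n →L[ℝ] ℝ)) ℝ -
    (covector y).comp ((ContinuousLinearMap.fst ℝ (BaseModel n) (BaseModel n →L[ℝ] ℝ)).comp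
      (ContinuousLinearMap.fst ℝ (BaseModel n × (BaseModel n →L[ℝ] ℝ)) ℝ))).comp
    (jetCoord y : TangentSpace (jetI n) y →L[ℝ] JetModel n)

/-- The two-form `dλ = dq ∧ dp`. -/
def dContactForm (y : OneJet n B) (v w : TangentSpace (jetI n) y) : ℝ :=
  (jetCoord y w).1.2 (jetCoord y v).1.1 - (jetCoord y v).1.2 (jetCoord y w).1.1

/-- The Reeb vector field `R_λ = ∂/∂z`. -/
def reeb (y : OneJet n B) : TangentSpace (jetI n) y := (jetCoord y).symm ((0, 0), 1)

/-- The projection `Π : T J^1B → ξ = ker λ` along the Reeb field. -/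
def contactProj (y : OneJet n B) : TangentSpace (jetI n) y →L[ℝ] TangentSpace (jetI n) y :=
  ContinuousLinearMap.id ℝ (TangentSpace (jetI n) y) - (contactForm y).smulRight (reeb y)

/-- The zero section `B → J^1B`. -/
def zeroJet (q : B) : OneJet n B := (⟨q, 0⟩, 0)

variable (n B) in
/-- The image `o_{J^1B}` of the zero section. -/
def jetZeroSection : Set (OneJet n B) := range zeroJet

theorem contactForm_apply (y : OneJet n B) (v : TangentSpace (jetI n) y) :
    contactForm y v = (jetCoord y v).2 - covector y (jetCoord y v).1.1 := rfl

/-- Coordinate-free form of `λ`: with the projections `z : J^1B → ℝ` and `π_B : J^1B → B`,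
`λ_y(v) = dz(v) - p(dπ_B(v))`. -/
theorem contactForm_eq (y : OneJet n B) (v : TangentSpace (jetI n) y) :
    contactForm y v =
      (show ℝ from mfderiv (jetI n) 𝓘(ℝ, ℝ) (fun x : OneJet n B => x.2) y v) -
        covector y (mfderiv (jetI n) (𝓡 n) (fun x : OneJet n B => x.1.1) y v) := by
  have h₂ : mfderiv (jetI n) 𝓘(ℝ, ℝ) (fun x : OneJet n B => x.2) y =
      ContinuousLinearMap.snd ℝ (BaseModel n × (BaseModel n →L[ℝ] ℝ)) ℝ := mfderiv_snd
  have h₁ : mfderiv (jetI n) (𝓡 n) (fun x : OneJet n B => x.1.1) y =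
      (ContinuousLinearMap.fst ℝ (BaseModel n) (BaseModel n →L[ℝ] ℝ)).comp
        (ContinuousLinearMap.fst ℝ (BaseModel n × (BaseModel n →L[ℝ] ℝ)) ℝ) := by
    have hπ : HasMFDerivAt ((𝓡 n).prod 𝓘(ℝ, BaseModel n →L[ℝ] ℝ)) (𝓡 n)
        (fun x : CotangentBundle n B => x.1) y.1
        (ContinuousLinearMap.fst ℝ (BaseModel n) (BaseModel n →L[ℝ] ℝ)) := by
      refine ⟨(FiberBundle.continuous_proj _ _).continuousAt, ?_⟩
      have hw : ∀ x ∈ (extChartAt ((𝓡 n).prod 𝓘(ℝ, BaseModel n →L[ℝ] ℝ)) y.1).target,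
          writtenInExtChartAt ((𝓡 n).prod 𝓘(ℝ, BaseModel n →L[ℝ] ℝ)) (𝓡 n) y.1
            (fun x : CotangentBundle n B => x.1) x =
          ContinuousLinearMap.fst ℝ (BaseModel n) (BaseModel n →L[ℝ] ℝ) x := by
        intro x hx
        rw [FiberBundle.extChartAt_target] at hx
        have h1 : ((extChartAt ((𝓡 n).prod 𝓘(ℝ, BaseModel n →L[ℝ] ℝ)) y.1).symm x).1 =
            (extChartAt (𝓡 n) y.1.1).symm x.1 := by
          rw [FiberBundle.extChartAt]
          exact Bundle.Trivialization.proj_symm_apply' (trivializationAt (BaseModel n →L[ℝ] ℝ)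
            (fun q : B => TangentSpace (𝓡 n) q →L[ℝ] Bundle.Trivial B ℝ q) y.1.1) hx.1.2
        simp only [writtenInExtChartAt, Function.comp_apply, h1]
        exact (extChartAt (𝓡 n) y.1.1).right_inv hx.1.1
      refine HasFDerivWithinAt.congr_of_eventuallyEq
        (ContinuousLinearMap.hasFDerivWithinAt _) ?_ (hw _ (mem_extChartAt_target y.1))
      filter_upwards [extChartAt_target_mem_nhdsWithin
        (I := (𝓡 n).prod 𝓘(ℝ, BaseModel n →L[ℝ] ℝ)) y.1] with x hx using hw x hx
    exact (hπ.comp y (hasMFDerivAt_fst y)).mfderiv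
  rw [h₁, h₂]
  rfl

/-! ## Contact Hamiltonian dynamics -/

/-- The differential `dh(y)` in canonical coordinates. -/
def jetDiff (h : OneJet n B → ℝ) (y : OneJet n B) : JetModel n →L[ℝ] ℝ :=
  (mfderiv (jetI n) 𝓘(ℝ, ℝ) h y : TangentSpace (jetI n) y →L[ℝ] ℝ).comp
    ((jetCoord y).symm : JetModel n →L[ℝ] TangentSpace (jetI n) y)

/-- The contact Hamiltonian vector field `X_h`: in canonical coordinates `q' = ∂h/∂p`,
`p' = - ∂h/∂q - p ∂h/∂z`, `z' = p ∂h/∂p - h`. It is the vector field determined by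
`λ(X_h) = - h` and `X_h ⌟ dλ = dh - R_λ[h] λ`, see the next three facts. -/
def hamVector (h : OneJet n B → ℝ) (y : OneJet n B) : TangentSpace (jetI n) y :=
  let a : BaseModel n := ∑ i : Fin n,
    jetDiff h y ((0, EuclideanSpace.proj i), 0) • EuclideanSpace.single i (1 : ℝ)
  let b : BaseModel n →L[ℝ] ℝ :=
    -((jetDiff h y).comp ((ContinuousLinearMap.inl ℝ _ ℝ).comp
      (ContinuousLinearMap.inl ℝ (BaseModel n) (BaseModel n →L[ℝ] ℝ))))
      - jetDiff h y ((0, 0), 1) • covector y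
  (jetCoord y).symm ((a, b), covector y a - h y)

theorem contactForm_hamVector (h : OneJet n B → ℝ) (y : OneJet n B) :
    contactForm y (hamVector h y) = - h y := by
  simp [contactForm_apply, hamVector]

theorem dContactForm_hamVector (h : OneJet n B → ℝ) (y : OneJet n B)
    (v : TangentSpace (jetI n) y) :
    dContactForm y (hamVector h y) v =
      jetDiff h y (jetCoord y v) - jetDiff h y (jetCoord y (reeb y)) * contactForm y v := by
  set D := jetDiff h y with hD
  set x := jetCoord y v with hx
  have key : ∀ b : BaseModel n →L[ℝ] ℝ,
      b (∑ i : Fin n, D ((0, EuclideanSpace.proj i), 0) • EuclideanSpace.single i (1 : ℝ)) =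
        D ((0, b), 0) := by
    intro b
    have hb : b = ∑ i : Fin n, b (EuclideanSpace.single i (1 : ℝ)) • EuclideanSpace.proj i := by
      ext w
      have hw : w = ∑ i : Fin n, w i • EuclideanSpace.single i (1 : ℝ) := by
        ext k
        simp [Pi.single_apply]
      conv_lhs => rw [hw]
      simp [mul_comm]
    have hD0 : D ((0, b), 0) = (D.comp ((ContinuousLinearMap.inl ℝ _ ℝ).comp
        (ContinuousLinearMap.inr ℝ (BaseModel n) (BaseModel n →L[ℝ] ℝ)))) b := rfl
    rw [hD0]
    conv_rhs => rw [hb]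
    simp [map_sum, mul_comm]
  have hR : jetCoord y (reeb y) = ((0, 0), 1) := rfl
  have hl : contactForm y v = x.2 - covector y x.1.1 := rfl
  have h1 : dContactForm y (hamVector h y) v =
      x.1.2 (∑ i : Fin n, D ((0, EuclideanSpace.proj i), 0) • EuclideanSpace.single i (1 : ℝ)) -
        (-(D ((x.1.1, 0), 0)) - D ((0, 0), 1) * covector y x.1.1) := rfl
  have h2 : D x = D ((x.1.1, 0), 0) + D ((0, x.1.2), 0) + x.2 * D ((0, 0), 1) := by
    rw [← smul_eq_mul, ← map_smul, ← map_add, ← map_add]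
    congr 1
    ext <;> simp
  rw [h1, hR, hl, key, h2]
  ring

theorem hamVector_unique (y : OneJet n B) (v w : TangentSpace (jetI n) y)
    (h₁ : contactForm y v = contactForm y w)
    (h₂ : ∀ u, dContactForm y v u = dContactForm y w u) : v = w := by
  apply (jetCoord y).injective
  have hb : (jetCoord y v).1.2 = (jetCoord y w).1.2 := by
    ext a
    simpa [dContactForm] using h₂ ((jetCoord y).symm ((a, 0), 0))
  have ha : (jetCoord y v).1.1 = (jetCoord y w).1.1 := by
    ext i
    simpa [dContactForm] using h₂ ((jetCoord y).symm ((0, EuclideanSpace.proj i), 0))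
  rw [contactForm_apply, contactForm_apply, ha] at h₁
  exact Prod.ext (Prod.ext ha hb) (by linarith)

/-- A smooth, compactly supported, time-dependent contact Hamiltonian on `[0,1] × J^1B`. -/
structure IsContactHamiltonian (H : ℝ → OneJet n B → ℝ) : Prop where
  smooth : ContMDiffOn (𝓘(ℝ, ℝ).prod (jetI n)) 𝓘(ℝ, ℝ) ∞
    (fun x : ℝ × OneJet n B => H x.1 x.2) (unitTime ×ˢ univ)
  compact_support : ∃ K : Set (OneJet n B), IsCompact K ∧
    ∀ t ∈ unitTime, ∀ y ∉ K, H t y = 0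

/-- `γ : [0,1] → J^1B` solves the contact Hamilton equation `γ'(t) = X_H(t, γ(t))`. -/
def IsHamTrajectory (H : ℝ → OneJet n B → ℝ) (γ : ℝ → OneJet n B) : Prop :=
  ∀ t ∈ unitTime, HasMFDerivWithinAt 𝓘(ℝ, ℝ) (jetI n) γ unitTime t
    (ContinuousLinearMap.toSpanSingleton ℝ (hamVector (H t) (γ t)))

open Classical in
/-- `hamFlow H s t y = γ(t)`, where `γ` is the solution of the contact Hamilton equation
on `[0,1]` with `γ(s) = y`. (For a smooth compactly supported `H` and `s ∈ [0,1]` there is exactly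
one such solution on `[0,1]`; the value `y` is used if there is none.) -/
def hamFlow (H : ℝ → OneJet n B → ℝ) (s t : ℝ) (y : OneJet n B) : OneJet n B :=
  if h : ∃ γ : ℝ → OneJet n B, IsHamTrajectory H γ ∧ γ s = y then h.choose t else y

/-- The contact flow `ψ_H^t`: trajectories with given initial condition. -/
def psiFlow (H : ℝ → OneJet n B → ℝ) (t : ℝ) : OneJet n B → OneJet n B := hamFlow H 0 t

/-- `φ_H^t = ψ_H^t ∘ (ψ_H^1)⁻¹`: trajectories with given final condition at time `1`. -/
def phiFlow (H : ℝ → OneJet n B → ℝ) (t : ℝ) : OneJet n B → OneJet n B := hamFlow H 1 t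

/-- The inverse `(φ_H^t)⁻¹ = ψ_H^1 ∘ (ψ_H^t)⁻¹`. -/
def phiFlowInv (H : ℝ → OneJet n B → ℝ) (t : ℝ) : OneJet n B → OneJet n B := hamFlow H t 1

/-- The conformal exponent `g_χ` of a co-orientation preserving contact diffeomorphism `χ`,
i.e. the function with `χ^*λ = e^{g_χ} λ`; it is read off by evaluating on the Reeb field. -/
def conformalExponent (χ : OneJet n B → OneJet n B) (y : OneJet n B) : ℝ :=
  Real.log (contactForm (χ y) (mfderiv (jetI n) (jetI n) χ y (reeb y)))

/-- The Legendrian submanifold `ψ_H^1(o_{J^1B})`. -/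
def movedZeroSection (H : ℝ → OneJet n B → ℝ) : Set (OneJet n B) :=
  psiFlow H 1 '' jetZeroSection n B

/-- The inclusion `B × ℝ → J^1B` of the Reeb trace `Z = o_{T^*B} × ℝ` of the zero section. -/
def reebTrace (x : B × ℝ) : OneJet n B := (⟨x.1, 0⟩, x.2)

/-- `ψ_H^1(o_{J^1B}) ⋔ Z` : at every common point `y`, the tangent spaces of the two submanifolds
span `T_y J^1B`. -/
def IsTransverseToReebTrace (H : ℝ → OneJet n B → ℝ) : Prop :=
  ∀ (q : B) (x : B × ℝ), psiFlow H 1 (zeroJet q) = reebTrace x →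
    ∀ v : JetModel n, ∃ (a : TangentSpace (𝓡 n) q)
      (b : TangentSpace ((𝓡 n).prod 𝓘(ℝ, ℝ)) x),
      v = jetCoord _ (mfderiv (𝓡 n) (jetI n) (fun q : B => psiFlow H 1 (zeroJet q)) q a) +
        jetCoord _ (mfderiv ((𝓡 n).prod 𝓘(ℝ, ℝ)) (jetI n) (reebTrace (n := n)) x b)

/-- A Reeb chord `(γ, T)` from `R₀` to `R₁`, parametrized by `[0,1]`: `γ' = T R_λ(γ)`,
`γ(0) ∈ R₀`, `γ(1) ∈ R₁`. -/
structure IsReebChord (R₀ R₁ : Set (OneJet n B)) (γ : ℝ → OneJet n B) (T : ℝ) : Prop where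
  isTrajectory : ∀ t ∈ unitTime, HasMFDerivWithinAt 𝓘(ℝ, ℝ) (jetI n) γ unitTime t
    (ContinuousLinearMap.toSpanSingleton ℝ (T • reeb (γ t)))
  source : γ 0 ∈ R₀
  target : γ 1 ∈ R₁

/-! ## The Sasakian almost complex structure and its lift -/

/-- A smooth Riemannian metric on `B`. -/
abbrev BaseMetric (n : ℕ) (B : Type*) [TopologicalSpace B] [ChartedSpace (BaseModel n) B]
    [IsManifold (𝓡 n) ∞ B] : Type _ :=
  Bundle.ContMDiffRiemannianMetric (𝓡 n) ∞ (BaseModel n) (fun q : B => TangentSpace (𝓡 n) q)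

variable (g : BaseMetric n B)

/-- The metric `g_q` as a bilinear form; as a map `T_qB → T_q^*B` it is `a ↦ g(a, ·)`. -/
def metricAt (q : B) : BaseModel n →L[ℝ] BaseModel n →L[ℝ] ℝ := g.inner q

/-- The inverse `T_q^*B → T_qB` of `a ↦ g(a, ·)`. -/
def sharp (q : B) : (BaseModel n →L[ℝ] ℝ) →L[ℝ] BaseModel n := (metricAt g q).inverse

theorem metricAt_isInvertible (q : B) : (metricAt g q).IsInvertible := by
  have hinj : Function.Injective (metricAt g q).toLinearMap := by
    rw [← LinearMap.ker_eq_bot, LinearMap.ker_eq_bot']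
    intro a ha
    by_contra hne
    have h0 : metricAt g q a a = 0 := by
      have := congrArg (fun f : BaseModel n →L[ℝ] ℝ => f a) ha
      simpa using this
    exact (g.pos q a hne).ne' h0
  have hdim : Module.finrank ℝ (BaseModel n) = Module.finrank ℝ (BaseModel n →L[ℝ] ℝ) := by
    rw [← (LinearMap.toContinuousLinearMap : (BaseModel n →ₗ[ℝ] ℝ) ≃ₗ[ℝ] _).finrank_eq]
    exact (Subspace.dual_finrank_eq).symm
  exact ⟨(LinearEquiv.ofInjectiveOfFinrankEq _ hinj hdim).toContinuousLinearEquiv, rfl⟩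

theorem metricAt_sharp (q : B) (p : BaseModel n →L[ℝ] ℝ) : metricAt g q (sharp g q p) = p := by
  obtain ⟨e, he⟩ := metricAt_isInvertible g q
  rw [sharp, ← he, ContinuousLinearMap.inverse_equiv]
  exact e.apply_symm_apply p

theorem sharp_metricAt (q : B) (a : BaseModel n) : sharp g q (metricAt g q a) = a := by
  obtain ⟨e, he⟩ := metricAt_isInvertible g q
  rw [sharp, ← he, ContinuousLinearMap.inverse_equiv]
  exact e.symm_apply_apply a

/-- The dual norm `|p|_g^2` on `T_q^*B`. -/
def covectorNormSq (q : B) (p : BaseModel n →L[ℝ] ℝ) : ℝ := p (sharp g q p)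

/-- The disc bundle `D_r(J^1B)` of radius `r`. -/
def jetDisc (r : ℝ) : Set (OneJet n B) :=
  {y | covectorNormSq g y.1.1 (covector y) + y.2 ^ 2 ≤ r ^ 2}

/-- The components `g_{ij}(x)` of the metric in the preferred chart at `q`. -/
def metricInChart (q : B) (x : BaseModel n) : BaseModel n →L[ℝ] BaseModel n →L[ℝ] ℝ :=
  let q' : B := (extChartAt (𝓡 n) q).symm x
  let F : BaseModel n →L[ℝ] BaseModel n :=
    (trivializationAt (BaseModel n) (TangentSpace (𝓡 n) : B → Type) q).symmL ℝ q'
  (metricAt g q').bilinearComp F F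

/-- The derivatives `a, v, w ↦ a^k v^i w^j ∂_k g_{ij}` at `q` in the preferred chart at `q`. -/
def metricDeriv (q : B) : BaseModel n →L[ℝ] BaseModel n →L[ℝ] BaseModel n →L[ℝ] ℝ :=
  fderiv ℝ (metricInChart g q) (extChartAt (𝓡 n) q q)

/-- The covector `v ↦ p(Γ(a, v)) = p_k Γ^k_{ij} a^i v^j`, with the Christoffel symbols
`Γ^k_{ij} = (1/2) g^{kl} (∂_i g_{jl} + ∂_j g_{il} - ∂_l g_{ij})` of the Levi-Civita connection. -/
def christoffelCovector (q : B) (p : BaseModel n →L[ℝ] ℝ) (a : BaseModel n) :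
    BaseModel n →L[ℝ] ℝ :=
  (1 / 2 : ℝ) • ((metricDeriv g q a).flip (sharp g q p)
    + ((metricDeriv g q).flip a).flip (sharp g q p) - metricDeriv g q (sharp g q p) a)

/-- The Sasakian almost complex structure `J_g` on `T_{(q,p)}T^*B` in canonical coordinates. With
the horizontal vectors `H_i = ∂/∂q^i + p_k Γ^k_{ij} ∂/∂p_j` and the vertical vectors
`V^i = ∂/∂p_i`, it is given by `H_i ↦ g_{ij} V^j`, `V^i ↦ - g^{ij} H_j`. -/
def sasaki (q : B) (p : BaseModel n →L[ℝ] ℝ) (x : BaseModel n × (BaseModel n →L[ℝ] ℝ)) :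
    BaseModel n × (BaseModel n →L[ℝ] ℝ) :=
  let s : BaseModel n := sharp g q (x.2 - christoffelCovector g q p x.1)
  (-s, metricAt g q x.1 - christoffelCovector g q p s)

/-- The lift of `J_g` to a CR almost complex structure on `J^1B`: it kills the Reeb field, takes
values in `ξ`, and corresponds to `J_g` under the isomorphism `ξ → T(T^*B)` induced
by the projection. -/
def sasakiLift (y : OneJet n B) (v : TangentSpace (jetI n) y) : TangentSpace (jetI n) y :=
  let x := sasaki g y.1.1 (covector y) (jetCoord y v).1
  (jetCoord y).symm (x, covector y x.1)

/-- A family of endomorphisms of `T J^1B`, parametrized by time. -/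
abbrev EndFamily (n : ℕ) (B : Type*) [TopologicalSpace B] [ChartedSpace (BaseModel n) B]
    [IsManifold (𝓡 n) ∞ B] : Type _ :=
  ℝ → (y : OneJet n B) → (TangentSpace (jetI n) y →L[ℝ] TangentSpace (jetI n) y)

/-- A smooth family `{J_t}`, `t ∈ [0,1]`, of `λ`-adapted CR almost complex structures on `J^1B`
which coincide with the lift of the Sasakian almost complex structure of `g` outside a compact
subset of `J^1B`. -/
structure IsAdaptedFamily (J : EndFamily n B) : Prop where
  smooth : ContMDiffOn (𝓘(ℝ, ℝ).prod (jetI n))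
    ((jetI n).prod 𝓘(ℝ, JetModel n →L[ℝ] JetModel n)) ∞
    (fun x : ℝ × OneJet n B =>
      (⟨x.2, J x.1 x.2⟩ : Bundle.TotalSpace (JetModel n →L[ℝ] JetModel n)
        (fun y : OneJet n B => TangentSpace (jetI n) y →L[ℝ] TangentSpace (jetI n) y)))
    (unitTime ×ˢ univ)
  sq : ∀ t ∈ unitTime, ∀ y v, J t y (J t y v) = - contactProj y v
  kills_reeb : ∀ t ∈ unitTime, ∀ y, J t y (reeb y) = 0
  adapted : ∀ t ∈ unitTime, ∀ y v, contactForm y v = 0 → v ≠ 0 → 0 < dContactForm y v (J t y v)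
  eq_lift : ∃ K : Set (OneJet n B), IsCompact K ∧
    ∀ t ∈ unitTime, ∀ y ∉ K, ∀ v, J t y v = sasakiLift g y v

/-! ## Contact instantons on the strip -/

/-- The strip `ℝ × [0,1]`, with coordinates `(τ, t)`. -/
def strip : Set (ℝ × ℝ) := univ ×ˢ unitTime

/-- The complex structure `j` of the strip: `j ∂_τ = ∂_t`, `j ∂_t = - ∂_τ`. -/
def stripJ : (ℝ × ℝ) →L[ℝ] (ℝ × ℝ) :=
  (-(ContinuousLinearMap.snd ℝ ℝ ℝ)).prod (ContinuousLinearMap.fst ℝ ℝ ℝ)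

/-- The one-form `dt`. -/
def stripDt : (ℝ × ℝ) →L[ℝ] ℝ := ContinuousLinearMap.snd ℝ ℝ ℝ

/-- The exterior derivative `dα(∂_τ, ∂_t)` of a one-form `α` on the strip. -/
def stripExtDeriv (α : ℝ × ℝ → ((ℝ × ℝ) →L[ℝ] ℝ)) (x : ℝ × ℝ) : ℝ :=
  fderivWithin ℝ α strip x (1, 0) (0, 1) - fderivWithin ℝ α strip x (0, 1) (1, 0)

/-- The differential `du` of a map on the strip. -/
def stripDiff (u : ℝ × ℝ → OneJet n B) (x : ℝ × ℝ) :
    (ℝ × ℝ) →L[ℝ] TangentSpace (jetI n) (u x) :=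
  mfderivWithin 𝓘(ℝ, ℝ × ℝ) (jetI n) u strip x

/-- The part `A^{π(0,1)} = (1/2) (Π A + J Π A j)` of a linear map `A : T(ℝ × [0,1]) → T_y J^1B`. -/
def piZeroOne {y : OneJet n B}
    (Jy : TangentSpace (jetI n) y →L[ℝ] TangentSpace (jetI n) y)
    (A : (ℝ × ℝ) →L[ℝ] TangentSpace (jetI n) y) : (ℝ × ℝ) →L[ℝ] TangentSpace (jetI n) y :=
  (1 / 2 : ℝ) • ((contactProj y).comp A + Jy.comp (((contactProj y).comp A).comp stripJ))

/-- A smooth map on the strip. -/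
def SmoothOnStrip (u : ℝ × ℝ → OneJet n B) : Prop :=
  ContMDiffOn 𝓘(ℝ, ℝ × ℝ) (jetI n) ∞ u strip

/-- Contact instantons `w : ℝ × [0,1] → J^1B`:
`∂̄^π w = (d^π w)^{(0,1)} = 0` and `d(w^*λ ∘ j) = 0`. -/
structure IsContactInstanton (J : EndFamily n B) (w : ℝ × ℝ → OneJet n B) : Prop where
  smooth : SmoothOnStrip w
  dbar : ∀ x ∈ strip, piZeroOne (J x.2 (w x)) (stripDiff w x) = 0
  closed : ∀ x ∈ strip, stripExtDeriv
    (fun x => ((contactForm (w x)).comp (stripDiff w x)).comp stripJ) x = 0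

/-- Hamiltonian perturbed contact instantons `u : ℝ × [0,1] → J^1B`:
`(du - X_H ⊗ dt)^{π(0,1)} = 0` and `d(e^{g_{H,u}} (u^*λ + H dt) ∘ j) = 0`, where `g_{H,u}(τ,t)` is
the conformal exponent of `(φ_H^t)⁻¹` at `u(τ,t)`. -/
structure IsPerturbedInstanton (H : ℝ → OneJet n B → ℝ) (J : EndFamily n B)
    (u : ℝ × ℝ → OneJet n B) : Prop where
  smooth : SmoothOnStrip u
  dbar : ∀ x ∈ strip, piZeroOne (J x.2 (u x))
    (stripDiff u x - stripDt.smulRight (hamVector (H x.2) (u x))) = 0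
  closed : ∀ x ∈ strip, stripExtDeriv
    (fun x => Real.exp (conformalExponent (phiFlowInv H x.2) (u x)) •
      (((contactForm (u x)).comp (stripDiff u x) + H x.2 (u x) • stripDt).comp stripJ)) x = 0

/-- `lim u(τ, ·) = γ` uniformly on `[0,1]` as `τ` tends to `±∞` (the filter `l` is `atTop`
or `atBot`). For a continuous `γ` this is convergence in `C^0([0,1], J^1B)`: `u(τ, t') → γ(t)`
whenever `τ → ±∞` and `t' → t` in `[0,1]`. -/
def StripLimit (l : Filter ℝ) (u : ℝ × ℝ → OneJet n B) (γ : ℝ → OneJet n B) : Prop :=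
  ∀ t ∈ unitTime, Tendsto u (l ×ˢ 𝓝[unitTime] t) (𝓝 (γ t))

end Jet

end

/-! ## The second derivative test -/

/-! The theorem is a maximum principle for `f = |p|_g^2 + z^2`. By compactness there is `C ≥ 0` such
that on `{f > C}` every `H_t` vanishes and every `J_t` is the Sasakian lift. The claim is that `f ∘
u ≤ C` on the whole strip, so the radius depends only on `H` and `J`.

On `{f > C}` both kinds of instanton satisfy the unperturbed equations: there `X_H = 0`, and
`(φ_H^t)⁻¹` is locally the identity, so its conformal exponent is `0`. Put `F = |p|_g^2 / 2` along
`u`. The identity `d(|p|_g^2 / 2) ∘ J_g = p dq` (`jetNormSqDiff_sasakiLift`) turns the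
Cauchy-Riemann equation into `F_t = p(q_τ)`, `F_τ = -p(q_t)`. Hence `ΔF = p_t(q_τ) - p_τ(q_t) =
dλ(u_τ, u_t) ≥ 0`. Closedness of `u^*λ ∘ j` reads `Δz = ∂_τ(p(q_τ)) + ∂_t(p(q_t))`, and the right
side is `F_tτ - F_τt = 0`, so `z` is harmonic. Therefore `Δ(2F + z^2) = 2ΔF + 2|∇z|^2 ≥ 0`. Adding
`ε t^2` makes the inequality strict, so the elementary second derivative test suffices
(`not_isLocalMax_of_subharmonic`, `not_isLocalMax_jetRadiusSq`).

It remains to bound `f` at the edges. The flow fixes `{f > C}` pointwise, so it preserves `{f ≤ C}`,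
which contains the zero section and hence its image under `ψ_H^1`. A Reeb chord ending on the zero
section has `p = 0` and `|z|` largest at its start, so it stays in `{f ≤ C}`, as does its image
under `φ_H^t`. Uniform convergence at both ends reduces the problem to a compact rectangle
(`jetRadiusSq_le_on_strip`). -/

theorem IsLocalMax.secondDeriv_nonpos {V : Type*} [NormedAddCommGroup V] [NormedSpace ℝ V]
    {φ : V → ℝ} {φ' : V → V →L[ℝ] ℝ} {φ'' : V →L[ℝ] V →L[ℝ] ℝ} {x : V} (hmax : IsLocalMax φ x)
    (h' : ∀ᶠ y in 𝓝 x, HasFDerivAt φ (φ' y) y) (h'' : HasFDerivAt φ' φ'' x) (v : V) :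
    φ'' v v ≤ 0 := by
  by_contra! hpos
  set l : ℝ → V := fun s => x + s • v with hl
  have hl0 : l 0 = x := by simp [hl]
  have hld : ∀ s, HasDerivAt l v s := fun s =>
    (((hasDerivAt_id s).smul_const v).const_add x).congr_deriv (one_smul ℝ v)
  have hlc : Tendsto l (𝓝 0) (𝓝 x) := by simpa [hl0] using (hld 0).continuousAt.tendsto
  have h1 : ∀ᶠ s in 𝓝 (0 : ℝ), deriv (φ ∘ l) s = φ' (l s) v := by
    filter_upwards [hlc.eventually h'] with s hs
    exact (hs.comp_hasDerivAt s (hld s)).deriv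
  have h2 : HasDerivAt (fun s => φ' (l s) v) (φ'' v v) 0 := by
    have h3 : HasFDerivAt φ' φ'' (l 0) := by rwa [hl0]
    exact (h3.comp_hasDerivAt 0 (hld 0)).clm_apply (hasDerivAt_const _ v) |>.congr_deriv (by simp)
  have h3 : deriv (deriv (φ ∘ l)) 0 = φ'' v v := by
    rw [EventuallyEq.deriv_eq h1]; exact h2.deriv
  have hmax' : IsLocalMax (φ ∘ l) 0 := by
    have : IsLocalMax φ (l 0) := by rwa [hl0]
    exact this.comp_continuous (hld 0).continuousAt
  -- A positive second derivative would make `0` a local minimum as well; then the function is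
  -- locally constant and its second derivative is zero.
  have hmin : IsLocalMin (φ ∘ l) 0 := isLocalMin_of_deriv_deriv_pos (by rwa [h3])
    hmax'.deriv_eq_zero ((hl0 ▸ h'.self_of_nhds : HasFDerivAt φ (φ' (l 0)) (l 0)).comp_hasDerivAt 0
      (hld 0)).continuousAt
  have hconst : φ ∘ l =ᶠ[𝓝 0] fun _ => (φ ∘ l) 0 := by
    filter_upwards [hmax', hmin] with s h1 h2 using le_antisymm h1 h2
  have hd : deriv (φ ∘ l) =ᶠ[𝓝 0] fun _ => 0 := by
    filter_upwards [eventually_eventually_nhds.2 hconst] with s hs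
    have := EventuallyEq.deriv_eq (f₁ := φ ∘ l) (f := fun _ => (φ ∘ l) 0) hs
    simpa using this
  have : deriv (deriv (φ ∘ l)) 0 = 0 := by rw [hd.deriv_eq]; simp
  rw [h3] at this
  exact hpos.ne' this

/-- Let `(Q, P, z)` be a map from the plane to `E × E^* × ℝ` and let `F` be a function with
`dF = P(∂_τ Q) dt - P(∂_t Q) dτ`. If the pullback of `dQ ∧ dP` is non-negative and
`(dz - P dQ) ∘ j` is closed at `x`, then `2 F + z^2 + ε t^2` has no local maximum at `x`. -/
theorem not_isLocalMax_of_subharmonic {E : Type*} [NormedAddCommGroup E] [NormedSpace ℝ E]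
    {Q : ℝ × ℝ → E} {P : ℝ × ℝ → E →L[ℝ] ℝ} {z F : ℝ × ℝ → ℝ} {x : ℝ × ℝ} {ε : ℝ} (hε : 0 < ε)
    (hQ : ContDiffAt ℝ 2 Q x) (hP : ContDiffAt ℝ 2 P x) (hz : ContDiffAt ℝ 2 z x)
    (hF : ∀ᶠ y in 𝓝 x, HasFDerivAt F (P y (fderiv ℝ Q y (1, 0)) • ContinuousLinearMap.snd ℝ ℝ ℝ -
      P y (fderiv ℝ Q y (0, 1)) • ContinuousLinearMap.fst ℝ ℝ ℝ) y)
    (hpos : 0 ≤ fderiv ℝ P x (0, 1) (fderiv ℝ Q x (1, 0)) -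
      fderiv ℝ P x (1, 0) (fderiv ℝ Q x (0, 1)))
    (hclosed : fderiv ℝ (fun y => fderiv ℝ z y (1, 0) - P y (fderiv ℝ Q y (1, 0))) x (1, 0) +
      fderiv ℝ (fun y => fderiv ℝ z y (0, 1) - P y (fderiv ℝ Q y (0, 1))) x (0, 1) = 0) :
    ¬ IsLocalMax (fun y => 2 * F y + z y ^ 2 + ε * y.2 ^ 2) x := by
  intro hmax
  have hQ1 : HasFDerivAt (fderiv ℝ Q) (fderiv ℝ (fderiv ℝ Q) x) x :=
    ((hQ.fderiv_right (m := 1) (by norm_num)).differentiableAt (by norm_num)).hasFDerivAt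
  have hz1 : HasFDerivAt (fderiv ℝ z) (fderiv ℝ (fderiv ℝ z) x) x :=
    ((hz.fderiv_right (m := 1) (by norm_num)).differentiableAt (by norm_num)).hasFDerivAt
  have hP1 : HasFDerivAt P (fderiv ℝ P x) x := (hP.differentiableAt (by norm_num)).hasFDerivAt
  have hQs : ∀ v w, fderiv ℝ (fderiv ℝ Q) x v w = fderiv ℝ (fderiv ℝ Q) x w v := fun v w =>
    (hQ.isSymmSndFDerivAt (by simp)).eq v w
  have hθ : ∀ v, HasFDerivAt (fun y => P y (fderiv ℝ Q y v))
      ((P x).comp ((fderiv ℝ (fderiv ℝ Q) x).flip v) + (fderiv ℝ P x).flip (fderiv ℝ Q x v)) x :=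
    fun v => by
      refine (hP1.clm_apply (hQ1.clm_apply (hasFDerivAt_const v x))).congr_fderiv ?_
      ext <;> simp
  have hzv : ∀ v, HasFDerivAt (fun y => fderiv ℝ z y v) ((fderiv ℝ (fderiv ℝ z) x).flip v) x :=
    fun v => by
      refine (hz1.clm_apply (hasFDerivAt_const v x)).congr_fderiv ?_
      ext <;> simp
  have hL : HasFDerivAt (fun y => P y (fderiv ℝ Q y (1, 0)) • ContinuousLinearMap.snd ℝ ℝ ℝ -
      P y (fderiv ℝ Q y (0, 1)) • ContinuousLinearMap.fst ℝ ℝ ℝ) _ x :=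
    ((hθ (1, 0)).smul_const (ContinuousLinearMap.snd ℝ ℝ ℝ)).sub
      ((hθ (0, 1)).smul_const (ContinuousLinearMap.fst ℝ ℝ ℝ))
  -- Equality of the mixed derivatives of `F` says `∂_τ(P Q_τ) + ∂_t(P Q_t) = 0`; combined with
  -- `hclosed` it gives `Δz = 0`.
  have hsymm := second_derivative_symmetric_of_eventually_of_real hF hL (1, 0) (0, 1)
  rw [((hzv (1, 0)).fun_sub (hθ (1, 0))).fderiv, ((hzv (0, 1)).fun_sub (hθ (0, 1))).fderiv]
    at hclosed
  have hφ : ∀ᶠ y in 𝓝 x, HasFDerivAt (fun y => 2 * F y + z y ^ 2 + ε * y.2 ^ 2)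
      ((2 : ℝ) • (P y (fderiv ℝ Q y (1, 0)) • ContinuousLinearMap.snd ℝ ℝ ℝ -
      P y (fderiv ℝ Q y (0, 1)) • ContinuousLinearMap.fst ℝ ℝ ℝ) + (2 * z y) • fderiv ℝ z y
        + (2 * ε * y.2) • ContinuousLinearMap.snd ℝ ℝ ℝ) y := by
    filter_upwards [hF, (hz.eventually (by simp))] with y hy hzy
    have h1 := (hzy.differentiableAt (by norm_num)).hasFDerivAt
    have h2 : HasFDerivAt (fun y : ℝ × ℝ => y.2) (ContinuousLinearMap.snd ℝ ℝ ℝ) y :=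
      hasFDerivAt_snd
    refine (((hy.const_mul 2).add (h1.pow 2)).add ((h2.pow 2).const_mul ε)).congr_fderiv ?_
    (ext <;> simp); ring
  have hφ' : HasFDerivAt (fun y => (2 : ℝ) • (P y (fderiv ℝ Q y (1, 0)) •
      ContinuousLinearMap.snd ℝ ℝ ℝ -
      P y (fderiv ℝ Q y (0, 1)) • ContinuousLinearMap.fst ℝ ℝ ℝ) + (2 * z y) • fderiv ℝ z y
        + (2 * ε * y.2) • ContinuousLinearMap.snd ℝ ℝ ℝ) _ x :=
    ((hL.const_smul (2 : ℝ)).add ((((hz.differentiableAt (by norm_num)).hasFDerivAt).const_mul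
      2).smul hz1)).add (((hasFDerivAt_snd (𝕜 := ℝ) (E := ℝ) (F := ℝ) (p := x)).const_mul
        (2 * ε)).smul_const (ContinuousLinearMap.snd ℝ ℝ ℝ))
  have h1 := hmax.secondDeriv_nonpos hφ hφ' (1, 0)
  have h2 := hmax.secondDeriv_nonpos hφ hφ' (0, 1)
  -- Symmetry of `D²Q` cancels the terms `P(Q_τt)` in `ΔF`, leaving only the term of `hpos`. The sum
  -- of `h1` and `h2` then contradicts `ε > 0`.
  have hQ01 := hQs (0, 1) (1, 0)
  simp at h1 h2 hsymm hclosed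
  rw [hQ01] at h2
  nlinarith [sq_nonneg (fderiv ℝ z x (1, 0)), sq_nonneg (fderiv ℝ z x (0, 1)),
    congrArg (fun r => z x * r) hclosed, congrArg (fun r => z x * r) hsymm]

/-! ### The dual norm in canonical charts and its differential. -/

section Metric

variable {n : ℕ} {B : Type*} [TopologicalSpace B] [ChartedSpace (BaseModel n) B]
  [IsManifold (𝓡 n) ∞ B] (g : BaseMetric n B)

/-- The coordinates of a covector in the canonical chart at `q₀`. -/
theorem cotangent_trivialization_snd (q₀ : B) (x : CotangentBundle n B) (v : BaseModel n) :
    ((trivializationAt (BaseModel n →L[ℝ] ℝ)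
      (fun q : B => TangentSpace (𝓡 n) q →L[ℝ] Bundle.Trivial B ℝ q) q₀ x).2 : BaseModel n →L[ℝ] ℝ) v
      = (x.2 : BaseModel n →L[ℝ] ℝ) ((trivializationAt (BaseModel n)
        (TangentSpace (𝓡 n) : B → Type) q₀).symmL ℝ x.1 v) := by
  rw [hom_trivializationAt_apply]
  simp [ContinuousLinearMap.inCoordinates]

theorem metricInChart_apply (q : B) (x : BaseModel n) (v w : BaseModel n) :
    metricInChart g q x v w = metricAt g ((extChartAt (𝓡 n) q).symm x)
      ((trivializationAt (BaseModel n) (TangentSpace (𝓡 n) : B → Type) q).symmL ℝ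
        ((extChartAt (𝓡 n) q).symm x) v)
      ((trivializationAt (BaseModel n) (TangentSpace (𝓡 n) : B → Type) q).symmL ℝ
        ((extChartAt (𝓡 n) q).symm x) w) := rfl

theorem differentiableAt_metricInChart (q : B) :
    DifferentiableAt ℝ (metricInChart g q) (extChartAt (𝓡 n) q q) := by
  have h := (Bundle.contMDiffAt_section q).1 (g.contMDiff q)
  have h2 := h.comp_of_eq (f := (extChartAt (𝓡 n) q).symm) (x := extChartAt (𝓡 n) q q)
    (contMDiffOn_extChartAt_symm q |>.contMDiffAt (extChartAt_target_mem_nhds q)) (by simp)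
  have h3 := (contMDiffAt_iff_contDiffAt.1 h2).differentiableAt (by simp)
  refine h3.congr_of_eventuallyEq ?_
  filter_upwards [extChartAt_target_mem_nhds (I := 𝓡 n) q] with x hx
  have hb : (extChartAt (𝓡 n) q).symm x ∈ (chartAt (BaseModel n) q).source := by
    simpa using (extChartAt (𝓡 n) q).map_target hx
  ext v w
  rw [metricInChart_apply, Function.comp_apply, hom_trivializationAt_apply,
    inCoordinates_apply_eq₂ (by simpa using hb) (by simpa using hb) (by simp)]
  refine Eq.trans ?_ (LinearMap.congr_fun
    (Bundle.Trivial.linearMapAt_trivialization (𝕜 := ℝ) (F := ℝ) (B := B) _) _).symm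
  exact congrArg₂ (fun a b => metricAt g ((extChartAt (𝓡 n) q).symm x) a b)
    (Bundle.Trivialization.symmL_apply _ (by simpa using hb) v)
    (Bundle.Trivialization.symmL_apply _ (by simpa using hb) w)

theorem ContinuousLinearMap.isInvertible_of_pos {L : BaseModel n →L[ℝ] BaseModel n →L[ℝ] ℝ}
    (hL : ∀ a, a ≠ 0 → 0 < L a a) : L.IsInvertible := by
  have hinj : Function.Injective L.toLinearMap := by
    rw [← LinearMap.ker_eq_bot, LinearMap.ker_eq_bot']
    intro a ha
    by_contra hne
    exact (hL a hne).ne' (by simpa using congrArg (fun f : BaseModel n →L[ℝ] ℝ => f a) ha)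
  have hdim : Module.finrank ℝ (BaseModel n) = Module.finrank ℝ (BaseModel n →L[ℝ] ℝ) := by
    rw [← (LinearMap.toContinuousLinearMap : (BaseModel n →ₗ[ℝ] ℝ) ≃ₗ[ℝ] _).finrank_eq]
    exact (Subspace.dual_finrank_eq).symm
  exact ⟨(LinearEquiv.ofInjectiveOfFinrankEq _ hinj hdim).toContinuousLinearEquiv, rfl⟩

theorem symmL_injective {q₀ q : B} (hq : q ∈ (chartAt (BaseModel n) q₀).source) :
    Function.Injective ((trivializationAt (BaseModel n)
      (TangentSpace (𝓡 n) : B → Type) q₀).symmL ℝ q) := by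
  rw [← Bundle.Trivialization.symm_continuousLinearEquivAt_eq _ (b := q) (by simpa using hq)]
  exact ContinuousLinearEquiv.injective _

theorem metricInChart_isInvertible {q₀ : B} {x : BaseModel n}
    (hx : x ∈ (extChartAt (𝓡 n) q₀).target) : (metricInChart g q₀ x).IsInvertible := by
  refine ContinuousLinearMap.isInvertible_of_pos fun a ha => ?_
  rw [metricInChart_apply]
  refine g.pos _ _ fun h => ha ?_
  exact symmL_injective (by simpa using (extChartAt (𝓡 n) q₀).map_target hx)
    (h.trans (map_zero _).symm)

/-- The dual norm in the canonical chart at `q₀`. -/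
theorem covectorNormSq_eq_inChart (q₀ : B) (x : CotangentBundle n B)
    (hx : x.1 ∈ (chartAt (BaseModel n) q₀).source) :
    covectorNormSq g x.1 x.2 =
      ((trivializationAt (BaseModel n →L[ℝ] ℝ)
        (fun q : B => TangentSpace (𝓡 n) q →L[ℝ] Bundle.Trivial B ℝ q) q₀ x).2)
        ((metricInChart g q₀ (extChartAt (𝓡 n) q₀ x.1)).inverse
        ((trivializationAt (BaseModel n →L[ℝ] ℝ)
        (fun q : B => TangentSpace (𝓡 n) q →L[ℝ] Bundle.Trivial B ℝ q) q₀ x).2)) := by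
  have hx' : x.1 ∈ (extChartAt (𝓡 n) q₀).source := by simpa using hx
  set F := (trivializationAt (BaseModel n) (TangentSpace (𝓡 n) : B → Type) q₀).symmL ℝ x.1 with hF
  set e := (trivializationAt (BaseModel n)
    (TangentSpace (𝓡 n) : B → Type) q₀).continuousLinearEquivAt ℝ x.1 (by simpa using hx)
  have hFe : ∀ v, F (e v) = v := fun v => by
    rw [hF, ← Bundle.Trivialization.symm_continuousLinearEquivAt_eq _ (by simpa using hx)]
    exact e.symm_apply_apply v
  obtain ⟨s, hs⟩ : ∃ s : TangentSpace (𝓡 n) x.1, s = sharp g x.1 x.2 := ⟨_, rfl⟩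
  -- The chart components of `p` are the image under `g_{ij}` of the chart components of its metric
  -- dual `s`.
  have hG : metricInChart g q₀ (extChartAt (𝓡 n) q₀ x.1) (e s) =
      (trivializationAt (BaseModel n →L[ℝ] ℝ)
        (fun q : B => TangentSpace (𝓡 n) q →L[ℝ] Bundle.Trivial B ℝ q) q₀ x).2 := by
    ext v
    rw [cotangent_trivialization_snd, metricInChart_apply, (extChartAt (𝓡 n) q₀).left_inv hx']
    rw [← hF]
    have h1 : metricAt g x.1 s = x.2 := by rw [hs]; exact metricAt_sharp g x.1 x.2
    exact (congrArg (fun a => metricAt g x.1 a (F v)) (hFe s)).trans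
      (congrArg (fun L : BaseModel n →L[ℝ] ℝ => L (F v)) h1)
  obtain ⟨E, hE⟩ := metricInChart_isInvertible g ((extChartAt (𝓡 n) q₀).map_source hx')
  rw [← hG, ← hE, ContinuousLinearMap.inverse_equiv]
  have h1 : (metricInChart g q₀ (extChartAt (𝓡 n) q₀ x.1)) (e s) (e s) =
      covectorNormSq g x.1 x.2 := by
    rw [hG, cotangent_trivialization_snd, ← hF]
    exact congrArg (x.2 : BaseModel n →L[ℝ] ℝ) ((hFe s).trans hs)
  rw [← h1, ← hE]
  exact congrArg (E (e s)) (E.symm_apply_apply (e s)).symm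

/-- The derivative of the dual norm of a variable covector for a variable metric. -/
theorem hasFDerivAt_dualNormSq {E : Type*} [NormedAddCommGroup E] [NormedSpace ℝ E]
    {V : Type*} [NormedAddCommGroup V] [NormedSpace ℝ V]
    {G : E → V →L[ℝ] V →L[ℝ] ℝ} [CompleteSpace V] {x : E} {p : V →L[ℝ] ℝ}
    {G' : E →L[ℝ] V →L[ℝ] V →L[ℝ] ℝ} (hG : HasFDerivAt G G' x)
    (hinv : ∀ᶠ y in 𝓝 x, (G y).IsInvertible) (hsymm : ∀ v w, G x v w = G x w v) :
    HasFDerivAt (fun y : E × (V →L[ℝ] ℝ) => y.2 ((G y.1).inverse y.2))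
      ((2 : ℝ) • (ContinuousLinearMap.apply ℝ ℝ ((G x).inverse p)).comp
        (ContinuousLinearMap.snd ℝ E (V →L[ℝ] ℝ)) -
        ((ContinuousLinearMap.apply ℝ ℝ ((G x).inverse p)).comp
          ((ContinuousLinearMap.apply ℝ (V →L[ℝ] ℝ) ((G x).inverse p)).comp G')).comp
          (ContinuousLinearMap.fst ℝ E (V →L[ℝ] ℝ))) (x, p) := by
  have h1 : HasFDerivAt (fun y : E × (V →L[ℝ] ℝ) => y.1)
      (ContinuousLinearMap.fst ℝ E (V →L[ℝ] ℝ)) (x, p) := hasFDerivAt_fst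
  have hG1 : HasFDerivAt (fun y : E × (V →L[ℝ] ℝ) => G y.1)
      (G'.comp (ContinuousLinearMap.fst ℝ E (V →L[ℝ] ℝ))) (x, p) :=
    HasFDerivAt.comp (F := E) (G := V →L[ℝ] V →L[ℝ] ℝ) (g := G) (x, p) hG h1
  have h2 : HasFDerivAt (fun y : E × (V →L[ℝ] ℝ) => y.2)
      (ContinuousLinearMap.snd ℝ E (V →L[ℝ] ℝ)) (x, p) := hasFDerivAt_snd
  have hinv' : DifferentiableAt ℝ (ContinuousLinearMap.inverse :
      (V →L[ℝ] V →L[ℝ] ℝ) → ((V →L[ℝ] ℝ) →L[ℝ] V)) (G x) :=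
    (hinv.self_of_nhds.contDiffAt_map_inverse (n := 1)).differentiableAt (by norm_num)
  have hI : DifferentiableAt ℝ (fun y : E × (V →L[ℝ] ℝ) => (G y.1).inverse) (x, p) :=
    DifferentiableAt.comp (𝕜 := ℝ) (E := E × (V →L[ℝ] ℝ)) (F := V →L[ℝ] V →L[ℝ] ℝ)
      (G := (V →L[ℝ] ℝ) →L[ℝ] V) (g := ContinuousLinearMap.inverse) (x, p) hinv' hG1.differentiableAt
  have hS : DifferentiableAt ℝ (fun y : E × (V →L[ℝ] ℝ) => (G y.1).inverse y.2) (x, p) :=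
    hI.clm_apply h2.differentiableAt
  obtain ⟨S', hS'⟩ : ∃ S', HasFDerivAt (fun y : E × (V →L[ℝ] ℝ) => (G y.1).inverse y.2) S' (x, p) :=
    ⟨_, hS.hasFDerivAt⟩
  -- With `s = G⁻¹ p`, the derivative of inversion is avoided by differentiating `G s = p`: this
  -- gives `G' s + G s' = p'`. Pairing with `s`, symmetry of `G` yields `p(s') = p'(s) - G'(s, s)`.
  have hGS := hG1.clm_apply hS'
  have heq : (fun y : E × (V →L[ℝ] ℝ) => G y.1 ((G y.1).inverse y.2)) =ᶠ[𝓝 (x, p)]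
      fun y => y.2 := by
    filter_upwards [continuousAt_fst.eventually hinv] with y hy
    obtain ⟨e, he⟩ := hy
    rw [← he, ContinuousLinearMap.inverse_equiv]
    exact e.apply_symm_apply _
  have hu := hGS.unique (h2.congr_of_eventuallyEq heq)
  have hp := heq.self_of_nhds
  simp only at hp
  refine (h2.clm_apply hS').congr_fderiv ?_
  ext v
  · have := congrArg (fun L : V →L[ℝ] ℝ => L ((G x).inverse p))
      (congrArg (fun L : E × (V →L[ℝ] ℝ) →L[ℝ] (V →L[ℝ] ℝ) => L (v, 0)) hu)
    have h3 := congrArg (fun L : V →L[ℝ] ℝ => L (S' (v, 0))) hp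
    have h4 := hsymm (S' (v, 0)) ((G x).inverse p)
    simp at this h3 ⊢
    linarith
  · have := congrArg (fun L : V →L[ℝ] ℝ => L ((G x).inverse p))
      (congrArg (fun L : E × (V →L[ℝ] ℝ) →L[ℝ] (V →L[ℝ] ℝ) => L (0, v)) hu)
    have h3 := congrArg (fun L : V →L[ℝ] ℝ => L (S' (0, v))) hp
    have h4 := hsymm (S' (0, v)) ((G x).inverse p)
    simp at this h3 ⊢
    linarith

theorem symmL_trivializationAt_self (q : B) (v : BaseModel n) :
    (trivializationAt (BaseModel n) (TangentSpace (𝓡 n) : B → Type) q).symmL ℝ q v = v := by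
  rw [TangentBundle.symmL_trivializationAt_eq_core (mem_chart_source _ q)]
  exact (tangentBundleCore (𝓡 n) B).coordChange_self _ q (mem_chart_source _ q) v

theorem metricInChart_self (q : B) :
    metricInChart g q (extChartAt (𝓡 n) q q) = metricAt g q := by
  -- The base point returned by the chart equals `q` only propositionally, so it is generalized
  -- before the fibres are identified.
  have h : ∀ q', q' = q → ∀ v w : BaseModel n, metricAt g q'
      ((trivializationAt (BaseModel n) (TangentSpace (𝓡 n) : B → Type) q).symmL ℝ q' v)
      ((trivializationAt (BaseModel n) (TangentSpace (𝓡 n) : B → Type) q).symmL ℝ q' w) =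
      metricAt g q v w := by
    rintro q' rfl v w
    exact congrArg₂ (fun a b => metricAt g q' a b) (symmL_trivializationAt_self q' v)
      (symmL_trivializationAt_self q' w)
  ext v w
  rw [metricInChart_apply]
  exact h _ (extChartAt_to_inv q) v w

/-- The canonical chart of `J^1B`. -/
theorem jet_extChartAt (y₀ y : OneJet n B) : extChartAt (jetI n) y₀ y =
    ((extChartAt (𝓡 n) y₀.1.1 y.1.1, (trivializationAt (BaseModel n →L[ℝ] ℝ)
        (fun q : B => TangentSpace (𝓡 n) q →L[ℝ] Bundle.Trivial B ℝ q) y₀.1.1 y.1).2), y.2) := by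
  rfl

theorem cotangent_trivialization_self (x : CotangentBundle n B) :
    (trivializationAt (BaseModel n →L[ℝ] ℝ)
      (fun q : B => TangentSpace (𝓡 n) q →L[ℝ] Bundle.Trivial B ℝ q) x.1 x).2 = x.2 := by
  ext v
  rw [cotangent_trivialization_snd]
  exact congrArg (x.2 : BaseModel n →L[ℝ] ℝ) (symmL_trivializationAt_self x.1 v)

/-- The function `y ↦ |p|_g^2` on `J^1B`. -/
noncomputable def jetNormSq (y : OneJet n B) : ℝ := covectorNormSq g y.1.1 (covector y)

/-- The differential of `|p|_g^2` in canonical coordinates. -/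
noncomputable def jetNormSqDiff (y : OneJet n B) : JetModel n →L[ℝ] ℝ :=
  ((2 : ℝ) • (ContinuousLinearMap.apply ℝ ℝ (sharp g y.1.1 (covector y))).comp
    (ContinuousLinearMap.snd ℝ (BaseModel n) (BaseModel n →L[ℝ] ℝ)) -
    ((ContinuousLinearMap.apply ℝ ℝ (sharp g y.1.1 (covector y))).comp
      ((ContinuousLinearMap.apply ℝ (BaseModel n →L[ℝ] ℝ) (sharp g y.1.1 (covector y))).comp
        (metricDeriv g y.1.1))).comp
      (ContinuousLinearMap.fst ℝ (BaseModel n) (BaseModel n →L[ℝ] ℝ))).comp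
  (ContinuousLinearMap.fst ℝ (BaseModel n × (BaseModel n →L[ℝ] ℝ)) ℝ)

theorem jetNormSqDiff_apply (y : OneJet n B) (v : JetModel n) :
    jetNormSqDiff g y v = 2 * v.1.2 (sharp g y.1.1 (covector y)) -
      metricDeriv g y.1.1 v.1.1 (sharp g y.1.1 (covector y)) (sharp g y.1.1 (covector y)) := by
  simp [jetNormSqDiff]

theorem hasMFDerivAt_jetNormSq (y : OneJet n B) :
    HasMFDerivAt (jetI n) 𝓘(ℝ, ℝ) (jetNormSq g) y
      ((jetNormSqDiff g y).comp (jetCoord y : TangentSpace (jetI n) y →L[ℝ] JetModel n)) := by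
  have hG : HasFDerivAt (metricInChart g y.1.1) (metricDeriv g y.1.1)
    (extChartAt (𝓡 n) y.1.1 y.1.1) := (differentiableAt_metricInChart g y.1.1).hasFDerivAt
  have h1 := hasFDerivAt_dualNormSq (p := covector y) hG
    (by
      filter_upwards [extChartAt_target_mem_nhds (I := 𝓡 n) y.1.1] with x hx
        using metricInChart_isInvertible g hx)
    (by intro v w; rw [metricInChart_self]; exact g.symm _ v w)
  rw [metricInChart_self] at h1
  have h2 : HasFDerivAt (fun x : JetModel n => x.1.2 ((metricInChart g y.1.1 x.1.1).inverse x.1.2))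
      (jetNormSqDiff g y) (extChartAt (jetI n) y y) := by
    rw [jet_extChartAt, cotangent_trivialization_self]
    have h3 : HasFDerivAt (fun x : JetModel n => x.1) (ContinuousLinearMap.fst ℝ
        (BaseModel n × (BaseModel n →L[ℝ] ℝ)) ℝ)
        ((extChartAt (𝓡 n) y.1.1 y.1.1, covector y), y.2) := hasFDerivAt_fst
    exact HasFDerivAt.comp (F := BaseModel n × (BaseModel n →L[ℝ] ℝ)) (G := ℝ)
      (((extChartAt (𝓡 n) y.1.1 y.1.1, covector y), y.2) : JetModel n) h1 h3
  -- A chart has identity derivative at its own centre, so the differential computed in the chart is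
  -- the one in `jetCoord`.
  have h3 : HasMFDerivAt (jetI n) 𝓘(ℝ, JetModel n) (extChartAt (jetI n) y) y
      (ContinuousLinearMap.id ℝ (TangentSpace (jetI n) y)) := by
    rw [← mfderiv_extChartAt_self]
    exact (mdifferentiableAt_extChartAt (mem_chart_source _ y)).hasMFDerivAt
  refine ((h2.hasMFDerivAt.comp y h3).congr_of_eventuallyEq ?_)
  filter_upwards [extChartAt_source_mem_nhds (I := jetI n) y] with y' hy'
  have hs : y'.1.1 ∈ (chartAt (BaseModel n) y.1.1).source := by
    simp [FiberBundle.chartedSpace_chartAt] at hy'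
    exact hy'.1.1
  rw [Function.comp_apply, jet_extChartAt]
  exact covectorNormSq_eq_inChart g y.1.1 y'.1 hs

theorem continuous_jetNormSq : Continuous (jetNormSq (n := n) (B := B) g) :=
  continuous_iff_continuousAt.2 fun y => (hasMFDerivAt_jetNormSq g y).continuousAt

theorem jetNormSqDiff_reeb (y : OneJet n B) : jetNormSqDiff g y (jetCoord y (reeb y)) = 0 := by
  simp [jetNormSqDiff_apply, reeb]

/-- The identity `d(|p|_g^2 / 2) ∘ J_g = p dq`. -/
theorem jetNormSqDiff_sasakiLift (y : OneJet n B) (v : TangentSpace (jetI n) y) :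
    jetNormSqDiff g y (jetCoord y (sasakiLift g y v)) = 2 * covector y (jetCoord y v).1.1 := by
  set s := sharp g y.1.1 (covector y) with hs
  -- Contracted with `s`, the metric dual of `p`, the last two terms of the Christoffel formula
  -- cancel. Geometrically, horizontal vectors preserve `|p|_g^2`.
  have hΓ : ∀ a, 2 * christoffelCovector g y.1.1 (covector y) a s =
      metricDeriv g y.1.1 a s s := by
    intro a
    simp [christoffelCovector, ← hs]
  rw [jetNormSqDiff_apply, ← hs]
  set a := (jetCoord y v).1.1 with ha
  have h1 : jetCoord y (sasakiLift g y v) = (sasaki g y.1.1 (covector y) (jetCoord y v).1,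
    covector y (sasaki g y.1.1 (covector y) (jetCoord y v).1).1) := rfl
  have h2 : metricAt g y.1.1 a s = covector y a := by
    have := congrArg (fun L : BaseModel n →L[ℝ] ℝ => L a) (metricAt_sharp g y.1.1 (covector y))
    rw [← this]
    exact g.symm _ _ _
  rw [h1]
  simp only [sasaki, ← ha, map_neg, neg_apply, sub_apply,
    mul_sub, hΓ, h2]
  ring

theorem jetNormSq_zeroJet (q : B) : jetNormSq g (zeroJet q : OneJet n B) = 0 := by
  change (0 : BaseModel n →L[ℝ] ℝ) _ = 0
  simp

end Metric

/-! ### The contact flow and the Reeb chords stay in a sublevel set of the radius. -/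

section Dynamics

variable {n : ℕ} {B : Type*} [TopologicalSpace B] [ChartedSpace (BaseModel n) B]
  [IsManifold (𝓡 n) ∞ B] (g : BaseMetric n B)

/-- The function `|p|_g^2 + z^2`. -/
noncomputable def jetRadiusSq (y : OneJet n B) : ℝ := jetNormSq g y + y.2 ^ 2

theorem continuous_jetRadiusSq : Continuous (jetRadiusSq (n := n) (B := B) g) :=
  (continuous_jetNormSq g).add (continuous_snd.pow 2)

theorem jetRadiusSq_zeroJet (q : B) : jetRadiusSq g (zeroJet q : OneJet n B) = 0 := by
  rw [jetRadiusSq, jetNormSq_zeroJet]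
  simp [zeroJet]

theorem exists_jetRadiusSq_le {K : Set (OneJet n B)} (hK : IsCompact K) :
    ∃ C, ∀ y ∈ K, jetRadiusSq g y ≤ C := by
  obtain ⟨C, hC⟩ := hK.bddAbove_image (continuous_jetRadiusSq g).continuousOn
  exact ⟨C, fun y hy => hC ⟨y, hy, rfl⟩⟩

theorem hasDerivWithinAt_comp_path {f : OneJet n B → ℝ} {γ : ℝ → OneJet n B} {s : Set ℝ} {t : ℝ}
    {D : TangentSpace (jetI n) (γ t) →L[ℝ] ℝ} {v : TangentSpace (jetI n) (γ t)}
    (hf : HasMFDerivAt (jetI n) 𝓘(ℝ, ℝ) f (γ t) D)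
    (hγ : HasMFDerivWithinAt 𝓘(ℝ, ℝ) (jetI n) γ s t (ContinuousLinearMap.toSpanSingleton ℝ v)) :
    HasDerivWithinAt (f ∘ γ) (D v) s t := by
  have h : HasFDerivWithinAt (f ∘ γ) ((D.comp (ContinuousLinearMap.toSpanSingleton ℝ v) :
      ℝ →L[ℝ] ℝ)) s t := (hf.comp_hasMFDerivWithinAt t hγ).hasFDerivWithinAt
  refine (hasFDerivWithinAt_iff_hasDerivWithinAt.1 h).congr_deriv ?_
  exact congrArg D (one_smul ℝ v)

/-- A path in `J^1B` whose velocity vanishes in an open set is locally constant there. -/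
theorem path_eventually_const {U : Set (OneJet n B)} (hU : IsOpen U) {γ : ℝ → OneJet n B}
    {γ' : (t : ℝ) → TangentSpace (jetI n) (γ t)}
    (hγ : ∀ t ∈ unitTime, HasMFDerivWithinAt 𝓘(ℝ, ℝ) (jetI n) γ unitTime t
      (ContinuousLinearMap.toSpanSingleton ℝ (γ' t)))
    (h0 : ∀ t ∈ unitTime, γ t ∈ U → γ' t = 0) {t : ℝ} (ht : t ∈ unitTime) (htU : γ t ∈ U) :
    ∀ᶠ s in 𝓝[unitTime] t, γ s = γ t := by
  have hc : ContinuousWithinAt γ unitTime t := (hγ t ht).continuousWithinAt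
  have hev : ∀ᶠ s in 𝓝[unitTime] t, γ s ∈ U ∩ (extChartAt (jetI n) (γ t)).source :=
    hc.eventually_mem (inter_mem (hU.mem_nhds htU) (extChartAt_source_mem_nhds (γ t)))
  obtain ⟨ε, hε, hball⟩ := Metric.mem_nhdsWithin_iff.1 hev
  filter_upwards [inter_mem_nhdsWithin unitTime (Metric.ball_mem_nhds t hε)] with s hs
  -- Inside one chart a path with zero derivative on an interval is constant, by the mean value
  -- inequality.
  have hconv : Convex ℝ (Metric.ball t ε ∩ unitTime) :=
    (convex_ball t ε).inter (convex_Icc 0 1)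
  have hd : ∀ x ∈ Metric.ball t ε ∩ unitTime, HasFDerivWithinAt
      (extChartAt (jetI n) (γ t) ∘ γ) (0 : ℝ →L[ℝ] JetModel n) (Metric.ball t ε ∩ unitTime) x := by
    intro x hx
    have hx' := hball hx
    have h1 : HasMFDerivAt (jetI n) 𝓘(ℝ, JetModel n) (extChartAt (jetI n) (γ t)) (γ x)
        (mfderiv (jetI n) 𝓘(ℝ, JetModel n) (extChartAt (jetI n) (γ t)) (γ x)) :=
      (mdifferentiableAt_extChartAt (by simpa only [extChartAt_source] using hx'.2)).hasMFDerivAt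
    have h2 := (h1.comp_hasMFDerivWithinAt x (hγ x hx.2)).hasFDerivWithinAt.mono
      (inter_subset_right (s := Metric.ball t ε))
    refine h2.congr_fderiv ?_
    rw [h0 x hx.2 hx'.1]
    ext
    exact congrArg (mfderiv (jetI n) 𝓘(ℝ, JetModel n) (extChartAt (jetI n) (γ t)) (γ x))
      (smul_zero _) |>.trans (map_zero _)
  have htm : t ∈ Metric.ball t ε ∩ unitTime := ⟨Metric.mem_ball_self hε, ht⟩
  have hs' : s ∈ Metric.ball t ε ∩ unitTime := ⟨hs.2, hs.1⟩
  have := hconv.norm_image_sub_le_of_norm_hasFDerivWithin_le (C := 0) hd (by simp) htm hs'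
  rw [zero_mul, norm_le_zero_iff, sub_eq_zero] at this
  exact (extChartAt (jetI n) (γ t)).injOn (hball hs').2 (hball htm).2 this

/-- A path in `J^1B` whose velocity vanishes where `f > C` is constant as soon as it passes
through a point where `f > C`. -/
theorem path_const {f : OneJet n B → ℝ} (hf : Continuous f) {C : ℝ} {γ : ℝ → OneJet n B}
    {γ' : (t : ℝ) → TangentSpace (jetI n) (γ t)}
    (hγ : ∀ t ∈ unitTime, HasMFDerivWithinAt 𝓘(ℝ, ℝ) (jetI n) γ unitTime t
      (ContinuousLinearMap.toSpanSingleton ℝ (γ' t)))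
    (h0 : ∀ t ∈ unitTime, C < f (γ t) → γ' t = 0) {s t : ℝ} (hs : s ∈ unitTime)
    (ht : t ∈ unitTime) (hC : C < f (γ s)) : γ t = γ s := by
  classical
  have hU : IsOpen {y | C < f y} := isOpen_lt continuous_const hf
  -- The truth value of `γ r = γ s` is locally constant: if `f (γ r) > C` the path is stationary
  -- near `r`, and otherwise `f (γ r) ≤ C < f (γ s)` keeps the equality false near `r`.
  -- Connectedness of `[0,1]` concludes.
  have hcont : ContinuousOn (fun r => decide (γ r = γ s)) unitTime := by
    intro r hr
    refine (continuousWithinAt_const (b := decide (γ r = γ s))).congr_of_eventuallyEq ?_ rfl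
    by_cases hrC : C < f (γ r)
    · filter_upwards [path_eventually_const hU hγ h0 hr hrC] with r' hr'
      rw [hr']
    · have hlt : f (γ r) < f (γ s) := (not_lt.1 hrC).trans_lt hC
      have hev : ∀ᶠ r' in 𝓝[unitTime] r, f (γ r') < f (γ s) :=
        (hf.continuousAt.comp_continuousWithinAt (hγ r hr).continuousWithinAt).eventually
          (gt_mem_nhds hlt)
      filter_upwards [hev] with r' hr'
      rw [decide_eq_false fun h => hr'.ne (congrArg f h),
        decide_eq_false fun h => hlt.ne (congrArg f h)]
  have := isPreconnected_Icc.constant hcont ht hs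
  simpa using this

variable {g} {H : ℝ → OneJet n B → ℝ} {C : ℝ}

theorem hamVector_eq_zero {h : OneJet n B → ℝ} {y : OneJet n B} (hh : h =ᶠ[𝓝 y] fun _ => 0) :
    hamVector h y = 0 := by
  have h1 : jetDiff h y = 0 := by
    rw [jetDiff, hh.mfderiv_eq, mfderiv_const]
    rfl
  apply (jetCoord y).injective
  simp [hamVector, h1, hh.self_of_nhds]

theorem eventually_eq_zero_of_lt_jetRadiusSq
    (hH : ∀ t ∈ unitTime, ∀ y, C < jetRadiusSq g y → H t y = 0)
    {t : ℝ} (ht : t ∈ unitTime) {y : OneJet n B} (hy : C < jetRadiusSq g y) :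
    H t =ᶠ[𝓝 y] fun _ => 0 := by
  filter_upwards [(continuous_jetRadiusSq g).continuousAt.eventually (lt_mem_nhds hy)] with x hx
    using hH t ht x hx

theorem hamTrajectory_const (hH : ∀ t ∈ unitTime, ∀ y, C < jetRadiusSq g y → H t y = 0)
    {γ : ℝ → OneJet n B} (hγ : IsHamTrajectory H γ) {s t : ℝ} (hs : s ∈ unitTime)
    (ht : t ∈ unitTime) (hC : C < jetRadiusSq g (γ s)) : γ t = γ s :=
  path_const (continuous_jetRadiusSq g) hγ (fun _ hr hrC =>
    hamVector_eq_zero (eventually_eq_zero_of_lt_jetRadiusSq hH hr hrC)) hs ht hC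

/-- If no trajectory exists, the default value of `hamFlow` is `y` itself, so neither existence nor
uniqueness of solutions is needed here. -/
theorem hamFlow_eq_self (hH : ∀ t ∈ unitTime, ∀ y, C < jetRadiusSq g y → H t y = 0) {s t : ℝ}
    (hs : s ∈ unitTime) (ht : t ∈ unitTime) {y : OneJet n B} (hy : C < jetRadiusSq g y) :
    hamFlow H s t y = y := by
  rw [hamFlow]
  split_ifs with h
  · have hspec := h.choose_spec
    rw [hamTrajectory_const hH hspec.1 hs ht (by rwa [hspec.2]), hspec.2]
  · rfl

/-- A trajectory that ever lies in `{f > C}` is constant, hence it was there at time `s` already. -/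
theorem jetRadiusSq_hamFlow_le (hH : ∀ t ∈ unitTime, ∀ y, C < jetRadiusSq g y → H t y = 0)
    {s t : ℝ} (hs : s ∈ unitTime) (ht : t ∈ unitTime) {y : OneJet n B}
    (hy : jetRadiusSq g y ≤ C) : jetRadiusSq g (hamFlow H s t y) ≤ C := by
  rw [hamFlow]
  split_ifs with h
  · have hspec := h.choose_spec
    by_contra! hlt
    have := hamTrajectory_const hH hspec.1 ht hs hlt
    rw [hspec.2] at this
    rw [← this] at hlt
    exact hlt.not_ge hy
  · exact hy

/-- The region `{f > C}` is open and fixed pointwise, so near `y` the map is the identity and its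
derivative fixes the Reeb field. -/
theorem conformalExponent_phiFlowInv (hH : ∀ t ∈ unitTime, ∀ y, C < jetRadiusSq g y → H t y = 0)
    {t : ℝ} (ht : t ∈ unitTime) {y : OneJet n B} (hy : C < jetRadiusSq g y) :
    conformalExponent (phiFlowInv H t) y = 0 := by
  have h1 : phiFlowInv H t =ᶠ[𝓝 y] id := by
    filter_upwards [(continuous_jetRadiusSq g).continuousAt.eventually (lt_mem_nhds hy)] with x hx
      using hamFlow_eq_self hH ht (by simp) hx
  have h2 : (mfderiv (jetI n) (jetI n) (phiFlowInv H t) y (reeb y) : JetModel n) = ((0, 0), 1) := by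
    have := h1.mfderiv_eq (I := jetI n) (I' := jetI n)
    rw [mfderiv_id] at this
    exact congrArg (fun L : JetModel n →L[ℝ] JetModel n => L ((0, 0), 1)) this
  have h3 : contactForm (phiFlowInv H t y)
      (mfderiv (jetI n) (jetI n) (phiFlowInv H t) y (reeb y)) = 1 := by
    refine (congrArg (fun v : JetModel n => v.2 - covector (phiFlowInv H t y) v.1.1) h2).trans ?_
    simp
  rw [conformalExponent, h3, Real.log_one]

theorem jetRadiusSq_le_of_mem_movedZeroSection (hC : 0 ≤ C)
    (hH : ∀ t ∈ unitTime, ∀ y, C < jetRadiusSq g y → H t y = 0) {y : OneJet n B}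
    (hy : y ∈ movedZeroSection H) : jetRadiusSq g y ≤ C := by
  obtain ⟨_, ⟨q, rfl⟩, rfl⟩ := hy
  exact jetRadiusSq_hamFlow_le hH (by simp) (by simp) (by rwa [jetRadiusSq_zeroJet])

/-- Along a chord `|p|_g^2` is constant, hence zero because it vanishes at the target, and `z = T (t
- 1)`. Thus `z^2` is largest at `t = 0`, where the chord lies in `R₀`. -/
theorem jetRadiusSq_reebChord_le {R₀ : Set (OneJet n B)} (hR : ∀ y ∈ R₀, jetRadiusSq g y ≤ C)
    {γ : ℝ → OneJet n B} {T : ℝ} (hγ : IsReebChord R₀ (jetZeroSection n B) γ T) {t : ℝ}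
    (ht : t ∈ unitTime) : jetRadiusSq g (γ t) ≤ C := by
  have hconst : ∀ f : ℝ → ℝ, (∀ t ∈ unitTime, HasDerivWithinAt f 0 unitTime t) →
      ∀ s ∈ unitTime, ∀ t ∈ unitTime, f s = f t := by
    intro f hf s hs t ht
    have := (convex_Icc (0 : ℝ) 1).norm_image_sub_le_of_norm_hasDerivWithin_le (C := 0) hf
      (by simp) ht hs
    rwa [zero_mul, norm_le_zero_iff, sub_eq_zero] at this
  have h1 : (1 : ℝ) ∈ unitTime := by simp
  have h0 : (0 : ℝ) ∈ unitTime := by simp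
  obtain ⟨q, hq⟩ := hγ.target
  have hN : ∀ t ∈ unitTime, jetNormSq g (γ t) = 0 := by
    intro t ht
    have := hconst (jetNormSq g ∘ γ) (fun t ht => by
      refine (hasDerivWithinAt_comp_path (hasMFDerivAt_jetNormSq g (γ t))
        (hγ.isTrajectory t ht)).congr_deriv ?_
      rw [map_smul]
      exact (congrArg (T • ·) (jetNormSqDiff_reeb g (γ t))).trans (smul_zero T)) t ht 1 h1
    rw [Function.comp_apply, Function.comp_apply, ← hq, jetNormSq_zeroJet] at this
    exact this
  have hz : ∀ t ∈ unitTime, (γ t).2 = T * (t - 1) := by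
    intro t ht
    have := hconst (fun t => (γ t).2 - T * t) (fun t ht => by
      have h2 := hasDerivWithinAt_comp_path (hasMFDerivAt_snd (γ t)) (hγ.isTrajectory t ht)
      refine (h2.sub ((hasDerivWithinAt_id t unitTime).const_mul T)).congr_deriv ?_
      have : (T • (((0, 0), 1) : JetModel n)).2 = T := by simp
      exact (congrArg (· - T * 1) this).trans (by ring)) t ht 1 h1
    simp only [← hq, zeroJet] at this
    linarith
  have hle := hR _ hγ.source
  rw [jetRadiusSq, hN _ h0, hz _ h0] at hle
  rw [jetRadiusSq, hN _ ht, hz _ ht]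
  nlinarith [ht.1, ht.2, mul_nonneg (sq_nonneg T) (mul_nonneg ht.1 (sub_nonneg.2 ht.2)),
    mul_nonneg (sq_nonneg T) ht.1]

end Dynamics

/-! ### Pointwise linear algebra of the instanton equation. -/

section Instanton

variable {n : ℕ} {B : Type*} [TopologicalSpace B] [ChartedSpace (BaseModel n) B]
  [IsManifold (𝓡 n) ∞ B] {g : BaseMetric n B}

theorem contactProj_apply (y : OneJet n B) (v : TangentSpace (jetI n) y) :
    contactProj y v = v - contactForm y v • reeb y := rfl

theorem contactForm_contactProj (y : OneJet n B) (v : TangentSpace (jetI n) y) :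
    contactForm y (contactProj y v) = 0 := by
  have h : contactForm y (reeb y) = 1 := by simp [contactForm_apply, reeb]
  rw [contactProj_apply, map_sub, map_smul, h]
  simp

theorem jetCoord_contactProj_fst (y : OneJet n B) (v : TangentSpace (jetI n) y) :
    (jetCoord y (contactProj y v)).1 = (jetCoord y v).1 := by
  rw [contactProj_apply, map_sub, map_smul]
  ext <;> simp [reeb]

theorem dContactForm_contactProj (y : OneJet n B) (v w : TangentSpace (jetI n) y) :
    dContactForm y (contactProj y v) (contactProj y w) = dContactForm y v w := by
  simp only [dContactForm, jetCoord_contactProj_fst]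

theorem jetNormSqDiff_contactProj (y : OneJet n B) (v : TangentSpace (jetI n) y) :
    jetNormSqDiff g y (jetCoord y (contactProj y v)) = jetNormSqDiff g y (jetCoord y v) := by
  simp only [jetNormSqDiff_apply, jetCoord_contactProj_fst]

section Linear

variable {y : OneJet n B} {Jy : TangentSpace (jetI n) y →L[ℝ] TangentSpace (jetI n) y}
  {A : (ℝ × ℝ) →L[ℝ] TangentSpace (jetI n) y}

theorem contactProj_dt_eq (h : piZeroOne Jy A = 0) :
    contactProj y (A (0, 1)) = Jy (contactProj y (A (1, 0))) := by
  have h1 : (1 / 2 : ℝ) • (contactProj y (A (0, 1)) +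
      Jy (contactProj y (A (-(1 : ℝ), (0 : ℝ))))) = 0 :=
    congrArg (fun L : (ℝ × ℝ) →L[ℝ] TangentSpace (jetI n) y => L (0, 1)) h
  have h2 : ((-(1 : ℝ), (0 : ℝ)) : ℝ × ℝ) = -(1, 0) := by simp
  rw [h2, map_neg, map_neg, map_neg, smul_eq_zero, ← sub_eq_add_neg, sub_eq_zero] at h1
  exact h1.resolve_left (by norm_num)

theorem contactProj_dtau_eq (h : piZeroOne Jy A = 0) :
    contactProj y (A (1, 0)) = -Jy (contactProj y (A (0, 1))) := by
  have h1 : (1 / 2 : ℝ) • (contactProj y (A (1, 0)) +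
      Jy (contactProj y (A (-(0 : ℝ), (1 : ℝ))))) = 0 :=
    congrArg (fun L : (ℝ × ℝ) →L[ℝ] TangentSpace (jetI n) y => L (1, 0)) h
  rw [neg_zero, smul_eq_zero, add_eq_zero_iff_eq_neg] at h1
  exact h1.resolve_left (by norm_num)

theorem jetNormSqDiff_dt (hJ : ∀ v, Jy v = sasakiLift g y v) (h : piZeroOne Jy A = 0) :
    jetNormSqDiff g y (jetCoord y (A (0, 1))) = 2 * covector y (jetCoord y (A (1, 0))).1.1 := by
  rw [← jetNormSqDiff_contactProj, contactProj_dt_eq h, hJ, jetNormSqDiff_sasakiLift,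
    jetCoord_contactProj_fst]

theorem jetNormSqDiff_dtau (hJ : ∀ v, Jy v = sasakiLift g y v) (h : piZeroOne Jy A = 0) :
    jetNormSqDiff g y (jetCoord y (A (1, 0))) = -(2 * covector y (jetCoord y (A (0, 1))).1.1) := by
  rw [← jetNormSqDiff_contactProj, contactProj_dtau_eq h, map_neg, map_neg, hJ,
    jetNormSqDiff_sasakiLift, jetCoord_contactProj_fst]

/-- Since `Π u_t = J Π u_τ` and `dλ` only sees the contact parts, the value is `dλ(v, Jv)` with `v =
Π u_τ`. -/
theorem dContactForm_nonneg
    (hJ : ∀ v, contactForm y v = 0 → v ≠ 0 → 0 < dContactForm y v (Jy v))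
    (h : piZeroOne Jy A = 0) : 0 ≤ dContactForm y (A (1, 0)) (A (0, 1)) := by
  rw [← dContactForm_contactProj, contactProj_dt_eq h]
  by_cases h0 : contactProj y (A (1, 0)) = 0
  · rw [h0, map_zero]
    simp [dContactForm]
  · exact (hJ _ (contactForm_contactProj _ _) h0).le

end Linear

/-! ### Maps to the one-jet bundle in a canonical chart -/

section Chart

variable {u : ℝ × ℝ → OneJet n B} {x : ℝ × ℝ} {A : (ℝ × ℝ) →L[ℝ] TangentSpace (jetI n) (u x)}

theorem hasFDerivAt_comp_of_hasMFDerivAt {f : OneJet n B → ℝ}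
    {D : TangentSpace (jetI n) (u x) →L[ℝ] ℝ} (hf : HasMFDerivAt (jetI n) 𝓘(ℝ, ℝ) f (u x) D)
    (hu : HasMFDerivAt 𝓘(ℝ, ℝ × ℝ) (jetI n) u x A) :
    HasFDerivAt (fun y => f (u y)) (D.comp A : (ℝ × ℝ) →L[ℝ] ℝ) x :=
  (hf.comp x hu).hasFDerivAt

theorem hasFDerivAt_extChartAt_comp (hu : HasMFDerivAt 𝓘(ℝ, ℝ × ℝ) (jetI n) u x A) :
    HasFDerivAt (fun y => extChartAt (jetI n) (u x) (u y))
      ((jetCoord (u x) : TangentSpace (jetI n) (u x) →L[ℝ] JetModel n).comp A) x := by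
  have h3 : HasMFDerivAt (jetI n) 𝓘(ℝ, JetModel n) (extChartAt (jetI n) (u x)) (u x)
      (ContinuousLinearMap.id ℝ (TangentSpace (jetI n) (u x))) := by
    rw [← mfderiv_extChartAt_self]
    exact (mdifferentiableAt_extChartAt (mem_chart_source _ (u x))).hasMFDerivAt
  exact (h3.comp x hu).hasFDerivAt

/-- Comparing the intrinsic formula `contactForm_eq` with the coordinate one and cancelling `dz`
identifies the two expressions for `p dq`. -/
theorem covector_mfderiv_base (y : OneJet n B) (v : TangentSpace (jetI n) y) :
    covector y (mfderiv (jetI n) (𝓡 n) (fun x : OneJet n B => x.1.1) y v) =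
      covector y (jetCoord y v).1.1 := by
  have h1 := contactForm_eq y v
  have h2 : (show ℝ from mfderiv (jetI n) 𝓘(ℝ, ℝ) (fun x : OneJet n B => x.2) y v) =
      (jetCoord y v).2 := by
    have : mfderiv (jetI n) 𝓘(ℝ, ℝ) (fun x : OneJet n B => x.2) y =
      ContinuousLinearMap.snd ℝ (BaseModel n × (BaseModel n →L[ℝ] ℝ)) ℝ := mfderiv_snd
    rw [this]
    rfl
  rw [h2, contactForm_apply] at h1
  linarith

/-- The form `p dq` in a canonical chart. -/
theorem covector_fderiv_inChart (hu : HasMFDerivAt 𝓘(ℝ, ℝ × ℝ) (jetI n) u x A) {q₀ : B}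
    (hq : (u x).1.1 ∈ (chartAt (BaseModel n) q₀).source) (v : ℝ × ℝ) :
    (trivializationAt (BaseModel n →L[ℝ] ℝ)
        (fun q : B => TangentSpace (𝓡 n) q →L[ℝ] Bundle.Trivial B ℝ q) q₀ (u x).1).2
      (fderiv ℝ (fun y => extChartAt (𝓡 n) q₀ (u y).1.1) x v) =
    covector (u x) (jetCoord (u x) (A v)).1.1 := by
  have hπ : MDifferentiableAt (jetI n) (𝓡 n) (fun x : OneJet n B => x.1.1) (u x) :=
    ((Bundle.contMDiff_proj _ (n := ∞)).mdifferentiable (by simp) _).comp (u x)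
      mdifferentiableAt_fst
  have h1 := hπ.hasMFDerivAt.comp x hu
  have h2 : HasMFDerivAt (𝓡 n) 𝓘(ℝ, BaseModel n) (extChartAt (𝓡 n) q₀) (u x).1.1
      (mfderiv (𝓡 n) 𝓘(ℝ, BaseModel n) (extChartAt (𝓡 n) q₀) (u x).1.1) :=
    (mdifferentiableAt_extChartAt hq).hasMFDerivAt
  obtain ⟨L, hL⟩ : ∃ L : (ℝ × ℝ) →L[ℝ] BaseModel n,
      L = (mfderiv (𝓡 n) 𝓘(ℝ, BaseModel n) (extChartAt (𝓡 n) q₀) (u x).1.1).comp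
        ((mfderiv (jetI n) (𝓡 n) (fun x : OneJet n B => x.1.1) (u x)).comp A) := ⟨_, rfl⟩
  have h3 : HasFDerivAt (fun y => extChartAt (𝓡 n) q₀ (u y).1.1) L x := by
    rw [hL]
    exact (h2.comp x h1).hasFDerivAt
  -- `jetCoord` at `u x` uses the chart centred there, while the left side uses the fixed chart at
  -- `q₀`. Both equal the intrinsic `p(dπ_B(A v))`, since covectors and tangent vectors transform
  -- contragrediently.
  rw [← covector_mfderiv_base]
  have h4 : fderiv ℝ (fun y => extChartAt (𝓡 n) q₀ (u y).1.1) x v =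
      (trivializationAt (BaseModel n) (TangentSpace (𝓡 n) : B → Type) q₀).continuousLinearMapAt ℝ
        (u x).1.1 (mfderiv (jetI n) (𝓡 n) (fun x : OneJet n B => x.1.1) (u x) (A v)) := by
    rw [TangentBundle.continuousLinearMapAt_trivializationAt hq, h3.fderiv, hL]
    rfl
  rw [h4, cotangent_trivialization_snd]
  exact congrArg (covector (u x))
    (Bundle.Trivialization.symmL_continuousLinearMapAt _ (by simpa using hq) _)

end Chart

end Instanton

/-! ### The maximum principle for the squared radius along an instanton. -/

section MaximumPrinciple

variable {n : ℕ} {B : Type*} [TopologicalSpace B] [ChartedSpace (BaseModel n) B]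
  [IsManifold (𝓡 n) ∞ B] {g : BaseMetric n B}

theorem strip_mem_nhds {x : ℝ × ℝ} (hx : x.2 ∈ Ioo (0 : ℝ) 1) : strip ∈ 𝓝 x :=
  prod_mem_nhds univ_mem (Icc_mem_nhds hx.1 hx.2)

theorem hasMFDerivAt_stripDiff {u : ℝ × ℝ → OneJet n B} (hu : SmoothOnStrip u) {x : ℝ × ℝ}
    (hx : strip ∈ 𝓝 x) : HasMFDerivAt 𝓘(ℝ, ℝ × ℝ) (jetI n) u x (stripDiff u x) := by
  rw [stripDiff, mfderivWithin_of_mem_nhds hx]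
  exact (((hu x (mem_of_mem_nhds hx)).contMDiffAt hx).mdifferentiableAt (by simp)).hasMFDerivAt

/-- Where a contact instanton stays in the region in which `J_t` is the lift of the Sasakian
structure, `|p|_g^2 + z^2 + ε t^2` has no interior local maximum along it. -/
theorem not_isLocalMax_jetRadiusSq {J : EndFamily n B} {u : ℝ × ℝ → OneJet n B} {C : ℝ}
    (hu : SmoothOnStrip u)
    (hlift : ∀ t ∈ unitTime, ∀ y, C < jetRadiusSq g y → ∀ v, J t y v = sasakiLift g y v)
    (hadapted : ∀ t ∈ unitTime, ∀ y v, contactForm y v = 0 → v ≠ 0 →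
      0 < dContactForm y v (J t y v))
    (hdbar : ∀ x ∈ strip, C < jetRadiusSq g (u x) → piZeroOne (J x.2 (u x)) (stripDiff u x) = 0)
    {x : ℝ × ℝ} (hx : x.2 ∈ Ioo (0 : ℝ) 1) (hxC : C < jetRadiusSq g (u x))
    (hclosed : stripExtDeriv
      (fun x => ((contactForm (u x)).comp (stripDiff u x)).comp stripJ) x = 0)
    {ε : ℝ} (hε : 0 < ε) : ¬ IsLocalMax (fun y => jetRadiusSq g (u y) + ε * y.2 ^ 2) x := by
  have hnhds := strip_mem_nhds hx
  have hA : HasMFDerivAt 𝓘(ℝ, ℝ × ℝ) (jetI n) u x (stripDiff u x) := hasMFDerivAt_stripDiff hu hnhds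
  have hcont : ContinuousAt u x := hA.continuousAt
  have hU : ContDiffAt ℝ ∞ (fun y => extChartAt (jetI n) (u x) (u y)) x :=
    contMDiffAt_iff_contDiffAt.1 (contMDiffAt_iff_target.1
      ((hu x (mem_of_mem_nhds hnhds)).contMDiffAt hnhds)).2
  -- Second derivatives need one fixed canonical chart, here the one at `u x`, whereas `jetCoord (u
  -- y)` moves with `y`.
  set Q : ℝ × ℝ → BaseModel n := fun y => extChartAt (𝓡 n) (u x).1.1 (u y).1.1 with hQdef
  set P : ℝ × ℝ → BaseModel n →L[ℝ] ℝ := fun y => (trivializationAt (BaseModel n →L[ℝ] ℝ)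
    (fun q : B => TangentSpace (𝓡 n) q →L[ℝ] Bundle.Trivial B ℝ q) (u x).1.1 (u y).1).2 with hPdef
  set z : ℝ × ℝ → ℝ := fun y => (u y).2 with hzdef
  have hU' : ContDiffAt ℝ ∞ (fun y => (((Q y, P y), z y) : JetModel n)) x := hU
  have hQ : ContDiffAt ℝ ∞ Q x := hU'.fst.fst
  have hP : ContDiffAt ℝ ∞ P x := hU'.fst.snd
  have hz : ContDiffAt ℝ ∞ z x := hU'.snd
  have hev : ∀ᶠ y in 𝓝 x, strip ∈ 𝓝 y ∧ C < jetRadiusSq g (u y) ∧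
      (u y).1.1 ∈ (chartAt (BaseModel n) (u x).1.1).source := by
    have h1 : ContinuousAt (fun y => (u y).1.1) x :=
      (FiberBundle.continuous_proj (BaseModel n →L[ℝ] ℝ) _).continuousAt.comp
        (continuousAt_fst.comp hcont)
    filter_upwards [eventually_mem_nhds_iff.2 hnhds,
      ((continuous_jetRadiusSq g).continuousAt.comp hcont).eventually (lt_mem_nhds hxC),
      h1.eventually_mem (chart_source_mem_nhds (BaseModel n) (u x).1.1)] with y h1 h2 h3
      using ⟨h1, h2, h3⟩
  have hp : ∀ᶠ y in 𝓝 x, ∀ v, P y (fderiv ℝ Q y v) =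
      covector (u y) (jetCoord (u y) (stripDiff u y v)).1.1 := by
    filter_upwards [hev] with y hy v
    exact covector_fderiv_inChart (hasMFDerivAt_stripDiff hu hy.1) hy.2.2 v
  have hzv : ∀ᶠ y in 𝓝 x, ∀ v, fderiv ℝ z y v = (jetCoord (u y) (stripDiff u y v)).2 := by
    filter_upwards [hev] with y hy v
    have := hasFDerivAt_comp_of_hasMFDerivAt (hasMFDerivAt_snd (u y))
      (hasMFDerivAt_stripDiff hu hy.1)
    rw [this.fderiv]
    rfl
  -- This is the Cauchy-Riemann equation in the form `F_t = p(q_τ)`, `F_τ = -p(q_t)` for `F =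
  -- |p|_g^2 / 2`.
  have hF : ∀ᶠ y in 𝓝 x, HasFDerivAt (fun y => (1 / 2 : ℝ) * jetNormSq g (u y))
      (P y (fderiv ℝ Q y (1, 0)) • ContinuousLinearMap.snd ℝ ℝ ℝ -
      P y (fderiv ℝ Q y (0, 1)) • ContinuousLinearMap.fst ℝ ℝ ℝ) y := by
    filter_upwards [hev, hp] with y hy hpy
    have hs : y ∈ strip := mem_of_mem_nhds hy.1
    have h1 := hasFDerivAt_comp_of_hasMFDerivAt (hasMFDerivAt_jetNormSq g (u y))
      (hasMFDerivAt_stripDiff hu hy.1)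
    have hJ := hlift y.2 hs.2 (u y) hy.2.1
    have hd := hdbar y hs hy.2.1
    refine (h1.const_mul (1 / 2 : ℝ)).congr_fderiv ?_
    rw [hpy, hpy]
    ext
    · have h2 := jetNormSqDiff_dtau hJ hd
      simp
      linarith
    · have h2 := jetNormSqDiff_dt hJ hd
      simp
      linarith
  obtain ⟨L, hL⟩ : ∃ L : (ℝ × ℝ) →L[ℝ] JetModel n,
      L = (jetCoord (u x) : TangentSpace (jetI n) (u x) →L[ℝ] JetModel n).comp (stripDiff u x) :=
    ⟨_, rfl⟩
  have hUd : HasFDerivAt (fun y => (((Q y, P y), z y) : JetModel n)) L x := by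
    rw [hL]
    exact hasFDerivAt_extChartAt_comp hA
  have hQd : ∀ v, fderiv ℝ Q x v = (jetCoord (u x) (stripDiff u x v)).1.1 := fun v => by
    rw [hUd.fst.fst.fderiv, hL]
    rfl
  have hPd : ∀ v, fderiv ℝ P x v = (jetCoord (u x) (stripDiff u x v)).1.2 := fun v => by
    rw [hUd.fst.snd.fderiv, hL]
    rfl
  have hpos : 0 ≤ fderiv ℝ P x (0, 1) (fderiv ℝ Q x (1, 0)) -
      fderiv ℝ P x (1, 0) (fderiv ℝ Q x (0, 1)) := by
    have hs : x ∈ strip := mem_of_mem_nhds hnhds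
    rw [hQd, hQd, hPd, hPd]
    exact dContactForm_nonneg (hadapted x.2 hs.2 (u x)) (hdbar x hs hxC)
  have hα : (fun y => ((contactForm (u y)).comp (stripDiff u y)).comp stripJ) =ᶠ[𝓝 x]
      fun y => (fderiv ℝ z y - (P y).comp (fderiv ℝ Q y)).comp stripJ := by
    filter_upwards [hp, hzv] with y hpy hzy
    ext <;> simp [hpy, hzy, contactForm_apply]
  have hclosed' : fderiv ℝ (fun y => fderiv ℝ z y (1, 0) - P y (fderiv ℝ Q y (1, 0))) x (1, 0) +
      fderiv ℝ (fun y => fderiv ℝ z y (0, 1) - P y (fderiv ℝ Q y (0, 1))) x (0, 1) = 0 := by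
    have hz1 : DifferentiableAt ℝ (fderiv ℝ z) x :=
      (hz.fderiv_right (m := 1) (by norm_cast)).differentiableAt (by norm_num)
    have hQ1 : DifferentiableAt ℝ (fderiv ℝ Q) x :=
      (hQ.fderiv_right (m := 1) (by norm_cast)).differentiableAt (by norm_num)
    have hβ : DifferentiableAt ℝ
        (fun y => (fderiv ℝ z y - (P y).comp (fderiv ℝ Q y)).comp stripJ) x :=
      (hz1.sub ((hP.differentiableAt (by norm_num)).clm_comp hQ1)).clm_comp
        (differentiableAt_const _)
    have hβv : ∀ v w, fderiv ℝ (fun y => (fderiv ℝ z y - (P y).comp (fderiv ℝ Q y)).comp stripJ)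
        x w v = fderiv ℝ (fun y => fderiv ℝ z y (stripJ v) - P y (fderiv ℝ Q y (stripJ v))) x w :=
      fun v w => by
        have := (hβ.hasFDerivAt.clm_apply (hasFDerivAt_const v x)).fderiv
        simp at this
        rw [this]
        simp
    have hj1 : stripJ (1, 0) = (0, 1) := by simp [stripJ]
    have hj2 : stripJ (0, 1) = -(1, 0) := by simp [stripJ]
    -- From `j ∂_τ = ∂_t` and `j ∂_t = -∂_τ`, closedness of `u^*λ ∘ j` becomes the divergence
    -- condition on `u^*λ`.
    rw [stripExtDeriv, fderivWithin_of_mem_nhds hnhds, hα.fderiv_eq, hβv, hβv, hj1, hj2] at hclosed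
    have hneg : (fun y => fderiv ℝ z y (-(1, 0)) - P y (fderiv ℝ Q y (-(1, 0)))) =
        fun y => -(fderiv ℝ z y (1, 0) - P y (fderiv ℝ Q y (1, 0))) := by
      ext y
      rw [map_neg, map_neg, map_neg]
      ring
    rw [hneg, fderiv_fun_neg, neg_apply] at hclosed
    linarith
  have hfun : (fun y => jetRadiusSq g (u y) + ε * y.2 ^ 2) =
      fun y => 2 * ((1 / 2 : ℝ) * jetNormSq g (u y)) + z y ^ 2 + ε * y.2 ^ 2 := by
    ext y
    rw [jetRadiusSq]
    ring
  rw [hfun]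
  exact not_isLocalMax_of_subharmonic hε (hQ.of_le (by norm_cast)) (hP.of_le (by norm_cast))
    (hz.of_le (by norm_cast)) hF hpos hclosed'

/-- The maximum principle on the strip. -/
theorem jetRadiusSq_le_on_strip {u : ℝ × ℝ → OneJet n B} {C : ℝ} (hu : ContinuousOn u strip)
    (hmax : ∀ x : ℝ × ℝ, x.2 ∈ Ioo (0 : ℝ) 1 → C < jetRadiusSq g (u x) → ∀ ε : ℝ, 0 < ε →
      ¬ IsLocalMax (fun y => jetRadiusSq g (u y) + ε * y.2 ^ 2) x)
    (h0 : ∀ τ : ℝ, jetRadiusSq g (u (τ, 0)) ≤ C) (h1 : ∀ τ : ℝ, jetRadiusSq g (u (τ, 1)) ≤ C)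
    {γm γp : ℝ → OneJet n B} (hm : StripLimit atBot u γm) (hp : StripLimit atTop u γp)
    (hγm : ∀ t ∈ unitTime, jetRadiusSq g (γm t) ≤ C)
    (hγp : ∀ t ∈ unitTime, jetRadiusSq g (γp t) ≤ C) {x : ℝ × ℝ} (hx : x ∈ strip) :
    jetRadiusSq g (u x) ≤ C := by
  by_contra! hlt
  -- The excess over `C` is split in three: one `δ` for the asymptotic ends and one for the
  -- perturbation `δ t^2 ≤ δ`, so the maximizer still exceeds `C` by at least `2δ`.
  obtain ⟨δ, hδ, hδx⟩ : ∃ δ : ℝ, 0 < δ ∧ jetRadiusSq g (u x) = C + 3 * δ :=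
    ⟨(jetRadiusSq g (u x) - C) / 3, by linarith, by ring⟩
  have hend : ∀ (l : Filter ℝ) (γ : ℝ → OneJet n B), StripLimit l u γ →
      (∀ t ∈ unitTime, jetRadiusSq g (γ t) ≤ C) →
      ∀ᶠ τ in l, ∀ t ∈ unitTime, jetRadiusSq g (u (τ, t)) < C + δ := by
    intro l γ hl hγ
    -- `StripLimit` is local in `t`; compactness of `[0,1]` makes the bound near the ends uniform in
    -- `t`.
    refine isCompact_Icc.induction_on
      (p := fun s => ∀ᶠ τ in l, ∀ t ∈ s, jetRadiusSq g (u (τ, t)) < C + δ) (by simp)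
      (fun s t hst ht => ht.mono fun τ h r hr => h r (hst hr))
      (fun s t hs ht => (hs.and ht).mono fun τ h r hr => hr.elim (h.1 r) (h.2 r)) fun t ht => ?_
    have h : ∀ᶠ y in l ×ˢ 𝓝[unitTime] t, jetRadiusSq g (u y) < C + δ :=
      (((continuous_jetRadiusSq g).tendsto (γ t)).comp (hl t ht)).eventually
        (gt_mem_nhds (by linarith [hγ t ht]))
    obtain ⟨p, hp, q, hq, hpq⟩ := eventually_prod_iff.1 h
    exact ⟨{t | q t}, hq, hp.mono fun τ hτ r hr => hpq hτ hr⟩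
  obtain ⟨a, ha⟩ := eventually_atBot.1 (hend _ _ hm hγm)
  obtain ⟨b, hb⟩ := eventually_atTop.1 (hend _ _ hp hγp)
  set R : Set (ℝ × ℝ) := Icc a b ×ˢ unitTime with hR
  have hxR : x ∈ R := by
    refine ⟨⟨?_, ?_⟩, hx.2⟩
    · by_contra! h
      have := ha x.1 h.le x.2 hx.2
      simp only [Prod.mk.eta] at this
      linarith
    · by_contra! h
      have := hb x.1 h.le x.2 hx.2
      simp only [Prod.mk.eta] at this
      linarith
  have hRc : IsCompact R := isCompact_Icc.prod isCompact_Icc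
  have hφ : ContinuousOn (fun y : ℝ × ℝ => jetRadiusSq g (u y) + δ * y.2 ^ 2) R :=
    ((continuous_jetRadiusSq g).comp_continuousOn (hu.mono fun y hy => ⟨mem_univ _, hy.2⟩)).add
      (by fun_prop)
  obtain ⟨y, hyR, hy⟩ := hRc.exists_isMaxOn ⟨x, hxR⟩ hφ
  have hyx := hy hxR
  simp only [mem_ofPred_eq, hδx] at hyx
  have hy2 : y.2 ^ 2 ≤ 1 := by
    have := hyR.2.1
    have := hyR.2.2
    nlinarith
  have hyC : C + 2 * δ ≤ jetRadiusSq g (u y) := by nlinarith [sq_nonneg x.2]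
  -- Every side of the rectangle is excluded: `f < C + δ` on the vertical sides and `f ≤ C` on the
  -- horizontal ones. The maximizer is therefore an interior local maximum.
  have hy1 : y.1 ∈ Ioo a b := by
    refine ⟨lt_of_le_of_ne hyR.1.1 fun h => ?_, lt_of_le_of_ne hyR.1.2 fun h => ?_⟩
    · have := ha y.1 h.ge y.2 hyR.2
      simp only [Prod.mk.eta] at this
      linarith
    · have := hb y.1 h.ge y.2 hyR.2
      simp only [Prod.mk.eta] at this
      linarith
  have hy2' : y.2 ∈ Ioo (0 : ℝ) 1 := by
    refine ⟨lt_of_le_of_ne hyR.2.1 fun h => ?_, lt_of_le_of_ne hyR.2.2 fun h => ?_⟩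
    · have := h0 y.1
      rw [h, Prod.mk.eta] at this
      linarith
    · have := h1 y.1
      rw [← h, Prod.mk.eta] at this
      linarith
  exact hmax y hy2' (by linarith) δ hδ (hy.isLocalMax
    (prod_mem_nhds (Icc_mem_nhds hy1.1 hy1.2) (Icc_mem_nhds hy2'.1 hy2'.2)))

end MaximumPrinciple

/-! ### Reduction of the perturbed equation to the unperturbed one, and the main theorem. -/

section Perturbed

variable {n : ℕ} {B : Type*} [TopologicalSpace B] [ChartedSpace (BaseModel n) B]
  [IsManifold (𝓡 n) ∞ B] {g : BaseMetric n B} {H : ℝ → OneJet n B → ℝ} {J : EndFamily n B} {C : ℝ}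

theorem image_subset_jetDisc (hC : 0 ≤ C) {u : ℝ × ℝ → OneJet n B}
    (h : ∀ x ∈ strip, jetRadiusSq g (u x) ≤ C) : u '' strip ⊆ jetDisc g (C + 1) := by
  rintro _ ⟨x, hx, rfl⟩
  -- The disc is defined by the square of its radius; for `C ≥ 0` one has `C ≤ (C + 1) ^ 2`, and `C
  -- + 1` is positive even when `C = 0`.
  have h1 : jetRadiusSq g (u x) ≤ (C + 1) ^ 2 := by nlinarith [h x hx]
  exact h1

/-- Where `H` vanishes, a perturbed contact instanton satisfies `∂̄^π u = 0`. -/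
theorem IsPerturbedInstanton.piZeroOne_eq_zero {u : ℝ × ℝ → OneJet n B}
    (hu : IsPerturbedInstanton H J u)
    (hH : ∀ t ∈ unitTime, ∀ y, C < jetRadiusSq g y → H t y = 0) {x : ℝ × ℝ} (hx : x ∈ strip)
    (hxC : C < jetRadiusSq g (u x)) : piZeroOne (J x.2 (u x)) (stripDiff u x) = 0 := by
  have h := hu.dbar x hx
  rw [hamVector_eq_zero (eventually_eq_zero_of_lt_jetRadiusSq hH hx.2 hxC)] at h
  have h1 : stripDiff u x - stripDt.smulRight (0 : TangentSpace (jetI n) (u x)) =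
      stripDiff u x := by
    rw [ContinuousLinearMap.smulRight_zero, sub_zero]
  rwa [h1] at h

/-- Where `H` vanishes, a perturbed contact instanton satisfies `d(u^*λ ∘ j) = 0`. -/
theorem IsPerturbedInstanton.stripExtDeriv_eq_zero {u : ℝ × ℝ → OneJet n B}
    (hu : IsPerturbedInstanton H J u)
    (hH : ∀ t ∈ unitTime, ∀ y, C < jetRadiusSq g y → H t y = 0) {x : ℝ × ℝ}
    (hx : x.2 ∈ Ioo (0 : ℝ) 1) (hxC : C < jetRadiusSq g (u x)) :
    stripExtDeriv (fun x => ((contactForm (u x)).comp (stripDiff u x)).comp stripJ) x = 0 := by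
  have hs : strip ∈ 𝓝 x := strip_mem_nhds hx
  have hcont : ContinuousAt u x := (hasMFDerivAt_stripDiff hu.smooth hs).continuousAt
  have heq : (fun x => Real.exp (conformalExponent (phiFlowInv H x.2) (u x)) •
      (((contactForm (u x)).comp (stripDiff u x) + H x.2 (u x) • stripDt).comp stripJ)) =ᶠ[𝓝 x]
      fun x => ((contactForm (u x)).comp (stripDiff u x)).comp stripJ := by
    filter_upwards [hs, ((continuous_jetRadiusSq g).continuousAt.comp hcont).eventually
      (lt_mem_nhds hxC)] with y hy hyC
    have h1 : conformalExponent (phiFlowInv H y.2) (u y) = 0 :=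
      conformalExponent_phiFlowInv hH hy.2 hyC
    rw [h1, hH y.2 hy.2 (u y) hyC, Real.exp_zero, one_smul, zero_smul, add_zero]
  have h := hu.closed x (mem_of_mem_nhds hs)
  rw [stripExtDeriv, fderivWithin_of_mem_nhds hs] at h ⊢
  rwa [heq.fderiv_eq] at h

end Perturbed

theorem mainTheorem8 {n : ℕ} {B : Type*} [TopologicalSpace B] [T2Space B] [CompactSpace B]
    [ChartedSpace (BaseModel n) B] [IsManifold (𝓡 n) ∞ B]
    (g : BaseMetric n B)
    (H : ℝ → OneJet n B → ℝ) (hH : IsContactHamiltonian H) (hT : IsTransverseToReebTrace H)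
    (J : EndFamily n B) (hJ : IsAdaptedFamily g J) :
    (∃ r : ℝ, 0 < r ∧
      ∀ (γm γp : ℝ → OneJet n B) (Tm Tp : ℝ),
        IsReebChord (movedZeroSection H) (jetZeroSection n B) γm Tm →
        IsReebChord (movedZeroSection H) (jetZeroSection n B) γp Tp →
        ∀ w : ℝ × ℝ → OneJet n B, IsContactInstanton J w →
          (∀ τ : ℝ, w (τ, 0) ∈ movedZeroSection H ∧ w (τ, 1) ∈ jetZeroSection n B) →
          StripLimit atBot w γm → StripLimit atTop w γp →
          w '' strip ⊆ jetDisc g r) ∧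
    (∃ r : ℝ, 0 < r ∧
      ∀ (γm γp : ℝ → OneJet n B) (Tm Tp : ℝ),
        IsReebChord (movedZeroSection H) (jetZeroSection n B) γm Tm →
        IsReebChord (movedZeroSection H) (jetZeroSection n B) γp Tp →
        ∀ u : ℝ × ℝ → OneJet n B, IsPerturbedInstanton H J u →
          (∀ τ : ℝ, u (τ, 0) ∈ jetZeroSection n B ∧ u (τ, 1) ∈ jetZeroSection n B) →
          StripLimit atBot u (fun t => phiFlow H t (γm t)) →
          StripLimit atTop u (fun t => phiFlow H t (γp t)) →
          u '' strip ⊆ jetDisc g r) := by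
  obtain ⟨K₁, hK₁, hHK⟩ := hH.compact_support
  obtain ⟨K₂, hK₂, hJK⟩ := hJ.eq_lift
  obtain ⟨C₁, hC₁⟩ := exists_jetRadiusSq_le g hK₁
  obtain ⟨C₂, hC₂⟩ := exists_jetRadiusSq_le g hK₂
  -- The value `0` in the maximum places the zero section, where the squared radius is `0`, inside
  -- the sublevel set.
  obtain ⟨C, hC, hCC₁, hCC₂⟩ : ∃ C : ℝ, 0 ≤ C ∧ C₁ ≤ C ∧ C₂ ≤ C :=
    ⟨max 0 (max C₁ C₂), le_max_left _ _, (le_max_left _ _).trans (le_max_right _ _),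
      (le_max_right _ _).trans (le_max_right _ _)⟩
  have hH0 : ∀ t ∈ unitTime, ∀ y, C < jetRadiusSq g y → H t y = 0 := fun t ht y hy =>
    hHK t ht y fun hyK => hy.not_ge ((hC₁ y hyK).trans hCC₁)
  have hlift : ∀ t ∈ unitTime, ∀ y, C < jetRadiusSq g y → ∀ v, J t y v = sasakiLift g y v :=
    fun t ht y hy => hJK t ht y fun hyK => hy.not_ge ((hC₂ y hyK).trans hCC₂)
  have hzero : ∀ y ∈ jetZeroSection n B, jetRadiusSq g y ≤ C := by
    rintro _ ⟨q, rfl⟩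
    rwa [jetRadiusSq_zeroJet]
  have hmoved : ∀ y ∈ movedZeroSection H, jetRadiusSq g y ≤ C := fun y hy =>
    jetRadiusSq_le_of_mem_movedZeroSection hC hH0 hy
  refine ⟨⟨C + 1, by linarith, ?_⟩, ⟨C + 1, by linarith, ?_⟩⟩
  · intro γm γp Tm Tp hγm hγp w hw hbdry hlm hlp
    refine image_subset_jetDisc hC fun x hx => jetRadiusSq_le_on_strip hw.smooth.continuousOn
      (fun x hx hxC ε hε => ?_) (fun τ => hmoved _ (hbdry τ).1) (fun τ => hzero _ (hbdry τ).2)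
      hlm hlp (fun t ht => jetRadiusSq_reebChord_le hmoved hγm ht)
      (fun t ht => jetRadiusSq_reebChord_le hmoved hγp ht) hx
    exact not_isLocalMax_jetRadiusSq hw.smooth hlift hJ.adapted (fun y hy _ => hw.dbar y hy) hx hxC
      (hw.closed x (mem_of_mem_nhds (strip_mem_nhds hx))) hε
  · intro γm γp Tm Tp hγm hγp u hu hbdry hlm hlp
    refine image_subset_jetDisc hC fun x hx => jetRadiusSq_le_on_strip hu.smooth.continuousOn
      (fun x hx hxC ε hε => ?_) (fun τ => hzero _ (hbdry τ).1) (fun τ => hzero _ (hbdry τ).2)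
      hlm hlp (fun t ht => jetRadiusSq_hamFlow_le hH0 (by simp) ht
        (jetRadiusSq_reebChord_le hmoved hγm ht))
      (fun t ht => jetRadiusSq_hamFlow_le hH0 (by simp) ht
        (jetRadiusSq_reebChord_le hmoved hγp ht)) hx
    exact not_isLocalMax_jetRadiusSq hu.smooth hlift hJ.adapted
      (fun y hy hyC => hu.piZeroOne_eq_zero hH0 hy hyC) hx hxC
      (hu.stripExtDeriv_eq_zero hH0 hx hxC) hε
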